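/- Let $K$ be a field complete for a discrete valuation $\mathrm{val}:K\to\mathbb Z\cup\{\infty\}$ that has an element of valuation $1$, and let $\mathbf X=(X_1,\dots,X_n)$. For $r\in\mathbb Q^n$ let $K\{\mathbf X;r\}$ be the Tate algebra of power series $\sum a_i\mathbf X^i$ over $K$ with $\mathrm{val}(a_i)-r\cdot i\to+\infty$ as $|i|\to\infty$. For $r\in\mathbb Q^n$ and a monomial order $m$, the term order $<_{r,m}$ is defined on nonzero terms by: $a\mathbf X^i<_{r,m}b\mathbf X^j$ if $\mathrm{val}(a)-r\cdot i>\mathrm{val}(b)-r\cdot j$, or if these two numbers are equal and $\mathbf X^i<_m\mathbf X^j$. The leading term $\mathrm{LT}_{r,m}(f)$ of $f\neq0$ is its largest term (coefficient included), and $\mathrm{LT}_{r,m}(0)=0$. A Gröbner basis of an ideal $J$ of $K\{\mathbf X;r\}$ with respect to $<_{r,m}$ is a set $G\subseteq J$ such that for every nonzero $f\in J$ some $\mathrm{LT}_{r,m}(g)$, $g\in G$, divides $\mathrm{LT}_{r,m}(f)$. For an ideal $I\subseteq K[\mathbf X]$ let $I_r$ be the ideal of $K\{\mathbf X;r\}$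 generated by $I$; a Gröbner basis of $I_r$ that consists of polynomials is called an $r$-local Gröbner basis of $I$. Fix a tie-breaking monomial order $m$. A universal analytic Gröbner basis (UAGB) of $I$ is a finite subset of $I$ that is an $r$-local Gröbner basis of $I$ with respect to $<_{r,m}$ for every $r\in\mathbb Q^n$. Let $F=(f_1,\dots,f_s)\in K[\mathbf X]^s$ and $I=\langle F\rangle$. Call two term orders $<_1,<_2$ (of the form $<_{r,m'}$, with any $r$ and any tie-break $m'$) equivalent with respect to $F$ if $\mathrm{LT}_{<_1}(f_i)=\mathrm{LT}_{<_2}(f_i)$ for all $i=1,\dots,s$. **Proposition.** (1) Let $R$ be any set of term orders that contains a representative of every equivalence class of term orders with respect to $F$. Then $F$ is a UAGB of $I$ if and only if, for every $<_{r,m'}$ in $R$, $F$ is a Gröbner basis of $I_r$ with respect to $<_{r,m'}$. (2) Assume that all $f_i$ are nonzero. Let $\mathcal N(F)\subset\mathbb R^{n+1}$ be the Minkowski sum over $i$ of the convex hulls of $\{(\mathrm{val}(c),\alpha): c\mathbf X^\alpha\text{ a term of }f_i\}+\mathbb R_{+}(1,0,\dots,0)$. Then the following algorithm TestUAGB is correct.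 It runs through the vertices $\beta$ of $\mathcal N(F)$, once each and in any order. For each $\beta$ it chooses some $u\in\mathbb Q^n$ such that the scalar product with $(1,u)$ has its unique minimum on $\mathcal N(F)$ at $\beta$, puts $r=-u$, computes some finite $r$-local Gröbner basis $G_r$ of $I$ (with respect to $<_{r,m}$), and, if some nonzero $g\in G_r$ is not reducible modulo $F$ (that is, if no $\mathrm{LT}_{r,m}(f_i)$ divides $\mathrm{LT}_{r,m}(g)$), returns $(\mathtt{False},r)$ and stops. If it gets through all the vertices, it returns $\mathtt{True}$. Correctness means: a complete run exists (there are finitely many vertices, and the required $u$ and $G_r$ exist); and, for every run, whatever choices are made, the output is $\mathtt{True}$ if and only if $F$ is a UAGB of $I$, and if the output is $(\mathtt{False},r)$, then $F$ is not an $r$-local Gröbner basis of $I$. -/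

import Mathlib

open scoped WithZero Pointwise

noncomputable section

namespace TateGB

/-! ## The valuation and Tate algebras

`K` is a field with a valuation written multiplicatively with values in `ℤᵐ⁰`; the additive
valuation of `c ≠ 0` is `-log (v c)`. -/

section Tate

variable {K : Type*} [Field K] [Valued K ℤᵐ⁰] {n : ℕ}

/-- The additive valuation of a nonzero element of `K` (its value at `0` is never used). -/
def val (c : K) : ℤ := -WithZero.log (Valued.v c)

/-- The Gauss valuation `val(c) - r · i` of the term `c X^i` with `c ≠ 0`. -/
def termVal (r : Fin n → ℚ) (i : Fin n →₀ ℕ) (c : K) : ℚ :=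
  (val c : ℚ) - ∑ j, r j * (i j : ℚ)

/-- The convergence condition: the Gauss valuations of the terms tend to `+∞`, i.e. for every
bound `B` only finitely many (nonzero) terms have Gauss valuation at most `B`. -/
def IsTate (r : Fin n → ℚ) (f : MvPowerSeries (Fin n) K) : Prop :=
  ∀ B : ℚ, {i : Fin n →₀ ℕ | MvPowerSeries.coeff i f ≠ 0 ∧
    termVal r i (MvPowerSeries.coeff i f) ≤ B}.Finite

theorem val_neg (c : K) : val (-c) = val c := by
  simp [val, Valuation.map_neg]

theorem val_mul {c d : K} (hc : c ≠ 0) (hd : d ≠ 0) : val (c * d) = val c + val d := by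
  have hc' : (Valued.v c : ℤᵐ⁰) ≠ 0 := (Valuation.ne_zero_iff _).2 hc
  have hd' : (Valued.v d : ℤᵐ⁰) ≠ 0 := (Valuation.ne_zero_iff _).2 hd
  simp only [val, map_mul, WithZero.log_mul hc' hd']
  ring

theorem exists_val_le_val_sum {ι : Type*} (s : Finset ι) (g : ι → K)
    (h : ∑ x ∈ s, g x ≠ 0) : ∃ x ∈ s, g x ≠ 0 ∧ val (g x) ≤ val (∑ x ∈ s, g x) := by
  have hv : (Valued.v (∑ x ∈ s, g x) : ℤᵐ⁰) ≠ 0 := (Valuation.ne_zero_iff _).2 h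
  by_contra! hcon
  have hlt : Valued.v (∑ x ∈ s, g x) < (Valued.v (∑ x ∈ s, g x) : ℤᵐ⁰) := by
    refine Valuation.map_sum_lt _ hv fun x hx => ?_
    by_cases h0 : g x = 0
    · rw [h0, map_zero]
      exact zero_lt_iff.2 hv
    · have h1 := hcon x hx h0
      have h2 : (Valued.v (g x) : ℤᵐ⁰) ≠ 0 := (Valuation.ne_zero_iff _).2 h0
      unfold val at h1
      exact (WithZero.log_lt_log h2 hv).1 (by linarith)
  exact lt_irrefl _ hlt

theorem IsTate.bddBelow {r : Fin n → ℚ} {f : MvPowerSeries (Fin n) K} (hf : IsTate r f) :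
    ∃ B : ℚ, ∀ i, MvPowerSeries.coeff i f ≠ 0 →
      B ≤ termVal r i (MvPowerSeries.coeff i f) := by
  obtain ⟨B, hB⟩ := ((hf 0).image fun i => termVal r i (MvPowerSeries.coeff i f)).bddBelow
  refine ⟨min B 0, fun i hi => ?_⟩
  rcases le_total (termVal r i (MvPowerSeries.coeff i f)) 0 with h | h
  · exact (min_le_left _ _).trans (hB ⟨i, ⟨hi, h⟩, rfl⟩)
  · exact (min_le_right _ _).trans h

theorem IsTate.add {r : Fin n → ℚ} {f g : MvPowerSeries (Fin n) K} (hf : IsTate r f)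
    (hg : IsTate r g) : IsTate r (f + g) := by
  intro B
  refine ((hf B).union (hg B)).subset ?_
  rintro i ⟨h0, hB⟩
  rw [map_add] at h0 hB
  have key := exists_val_le_val_sum (K := K) (Finset.univ : Finset Bool)
    (fun b => if b then MvPowerSeries.coeff i f else MvPowerSeries.coeff i g)
    (by simpa using h0)
  obtain ⟨b, -, hb0, hb⟩ := key
  have hb' : ((val (if b then MvPowerSeries.coeff i f else MvPowerSeries.coeff i g) : ℤ) : ℚ)
      ≤ val (MvPowerSeries.coeff i f + MvPowerSeries.coeff i g) := by
    exact_mod_cast (by simpa using hb)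
  unfold termVal at hB
  cases b
  · right
    refine ⟨by simpa using hb0, ?_⟩
    simp only [Bool.false_eq_true, if_false] at hb'
    unfold termVal
    linarith
  · left
    refine ⟨by simpa using hb0, ?_⟩
    simp only [if_true] at hb'
    unfold termVal
    linarith

theorem IsTate.mul {r : Fin n → ℚ} {f g : MvPowerSeries (Fin n) K} (hf : IsTate r f)
    (hg : IsTate r g) : IsTate r (f * g) := by
  classical
  obtain ⟨Bf, hBf⟩ := hf.bddBelow
  obtain ⟨Bg, hBg⟩ := hg.bddBelow
  intro B
  refine ((hf (B - Bg)).add (hg (B - Bf))).subset ?_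
  rintro k ⟨h0, hB⟩
  rw [MvPowerSeries.coeff_mul] at h0 hB
  obtain ⟨⟨i, j⟩, hij, hne, hle⟩ := exists_val_le_val_sum _ _ h0
  rw [Finset.HasAntidiagonal.mem_antidiagonal] at hij
  have hi : MvPowerSeries.coeff i f ≠ 0 := left_ne_zero_of_mul hne
  have hj : MvPowerSeries.coeff j g ≠ 0 := right_ne_zero_of_mul hne
  have hsum : termVal r i (MvPowerSeries.coeff i f) + termVal r j (MvPowerSeries.coeff j g)
      ≤ B := by
    refine le_trans ?_ hB
    have hle' : ((val (MvPowerSeries.coeff i f) : ℤ) : ℚ) + val (MvPowerSeries.coeff j g)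
        ≤ val (∑ p ∈ Finset.HasAntidiagonal.antidiagonal k,
          MvPowerSeries.coeff p.1 f * MvPowerSeries.coeff p.2 g) := by
      rw [← Int.cast_add, ← val_mul hi hj]
      exact_mod_cast hle
    have hk : ∑ l, r l * (k l : ℚ) = ∑ l, r l * (i l : ℚ) + ∑ l, r l * (j l : ℚ) := by
      simp only at hij
      rw [← hij, ← Finset.sum_add_distrib]
      refine Finset.sum_congr rfl fun l _ => ?_
      rw [Finsupp.add_apply]
      push_cast
      ring
    unfold termVal
    rw [hk]
    linarith
  refine Set.mem_add.2 ⟨i, ⟨hi, ?_⟩, j, ⟨hj, ?_⟩, hij⟩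
  · linarith [hBg j hj]
  · linarith [hBf i hi]

theorem isTate_coe (r : Fin n → ℚ) (p : MvPolynomial (Fin n) K) :
    IsTate r (p : MvPowerSeries (Fin n) K) := by
  intro B
  refine p.support.finite_toSet.subset ?_
  rintro i ⟨h0, -⟩
  simpa [MvPolynomial.mem_support_iff] using h0

/-- The Tate algebra `K{X; r}` with convergence log-radii `r`, as a ring of power series. -/
def tateAlgebra (K : Type*) [Field K] [Valued K ℤᵐ⁰] {n : ℕ} (r : Fin n → ℚ) :
    Subring (MvPowerSeries (Fin n) K) where
  carrier := {f | IsTate r f}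
  zero_mem' := by
    have := isTate_coe r (0 : MvPolynomial (Fin n) K)
    simpa using this
  one_mem' := by
    have := isTate_coe r (1 : MvPolynomial (Fin n) K)
    simpa using this
  add_mem' := IsTate.add
  mul_mem' := IsTate.mul
  neg_mem' := by
    intro f hf B
    refine (hf B).subset ?_
    rintro i ⟨h0, hB⟩
    rw [map_neg] at h0 hB
    refine ⟨neg_ne_zero.1 h0, ?_⟩
    unfold termVal at hB ⊢
    rwa [val_neg] at hB

/-- The inclusion `K[X] → K{X; r}`. -/
def polyToTate (r : Fin n → ℚ) : MvPolynomial (Fin n) K →+* tateAlgebra K r :=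
  MvPolynomial.coeToMvPowerSeries.ringHom.codRestrict (tateAlgebra K r) fun p => by
    rw [MvPolynomial.coeToMvPowerSeries.ringHom_apply]
    exact isTate_coe r p

/-- The ideal `I_r` of `K{X; r}` generated by the polynomials of `I`. -/
def completedIdeal (r : Fin n → ℚ) (I : Ideal (MvPolynomial (Fin n) K)) :
    Ideal (tateAlgebra K r) :=
  I.map (polyToTate r)

end Tate

/-! ## Term orders, leading terms, Gröbner bases -/

/-- A term order `<_{r,m}`: convergence log-radii together with a tie-breaking monomial order. -/
structure TermOrder (n : ℕ) where
  radii : Fin n → ℚ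
  tieBreak : MonomialOrder.{0, 0} (Fin n)

section Groebner

variable {K : Type*} [Field K] [Valued K ℤᵐ⁰] {n : ℕ}

/-- `a X^i <_{r,m} b X^j` for nonzero `a`, `b`. -/
def TermOrder.termLT (o : TermOrder n) (i : Fin n →₀ ℕ) (a : K) (j : Fin n →₀ ℕ) (b : K) : Prop :=
  termVal o.radii j b < termVal o.radii i a ∨
    (termVal o.radii i a = termVal o.radii j b ∧ o.tieBreak.toSyn i < o.tieBreak.toSyn j)

/-- `e` is the exponent of the largest term of `f`. -/
def TermOrder.IsLeadingExp (o : TermOrder n) (f : MvPowerSeries (Fin n) K) (e : Fin n →₀ ℕ) :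
    Prop :=
  MvPowerSeries.coeff e f ≠ 0 ∧ ∀ d, d ≠ e → MvPowerSeries.coeff d f ≠ 0 →
    o.termLT d (MvPowerSeries.coeff d f) e (MvPowerSeries.coeff e f)

open Classical in
/-- The leading term (coefficient times monomial) of `f`, and `0` for `f = 0`. -/
def TermOrder.leadingTerm (o : TermOrder n) (f : MvPowerSeries (Fin n) K) :
    MvPolynomial (Fin n) K :=
  if h : ∃ e, o.IsLeadingExp f e then
    MvPolynomial.monomial h.choose (MvPowerSeries.coeff h.choose f)
  else 0

/-- `G` is a Gröbner basis of the ideal `J` of `K{X; r}` for the order `<_{r,m}`. -/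
def TermOrder.IsGroebnerBasis (o : TermOrder n) (J : Ideal (tateAlgebra K o.radii))
    (G : Set (tateAlgebra K o.radii)) : Prop :=
  G ⊆ (J : Set (tateAlgebra K o.radii)) ∧
    ∀ f ∈ J, f ≠ 0 → ∃ g ∈ G,
      o.leadingTerm (g : MvPowerSeries (Fin n) K) ∣ o.leadingTerm (f : MvPowerSeries (Fin n) K)

/-- The set `G` of polynomials is an `r`-local Gröbner basis of the polynomial ideal `I`, that is,
a Gröbner basis of `I_r`. -/
def TermOrder.IsLocalGB (o : TermOrder n) (I : Ideal (MvPolynomial (Fin n) K))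
    (G : Set (MvPolynomial (Fin n) K)) : Prop :=
  o.IsGroebnerBasis (completedIdeal o.radii I) (polyToTate o.radii '' G)

/-- `G` is a universal analytic Gröbner basis of `I` (`m` is the fixed tie-breaking order). -/
def IsUAGB (m : MonomialOrder.{0, 0} (Fin n)) (I : Ideal (MvPolynomial (Fin n) K))
    (G : Set (MvPolynomial (Fin n) K)) : Prop :=
  G.Finite ∧ G ⊆ (I : Set (MvPolynomial (Fin n) K)) ∧
    ∀ r : Fin n → ℚ, TermOrder.IsLocalGB ⟨r, m⟩ I G

/-- Two term orders are equivalent with respect to the tuple `F` if they select the same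
leading terms `(LT(f₁), …, LT(f_s))`. -/
def TermOrder.Equivalent {s : ℕ} (F : Fin s → MvPolynomial (Fin n) K) (o o' : TermOrder n) :
    Prop :=
  ∀ i, o.leadingTerm (F i : MvPowerSeries (Fin n) K) =
    o'.leadingTerm (F i : MvPowerSeries (Fin n) K)

/-- `R` contains a representative of every equivalence class of term orders w.r.t. `F`. -/
def MeetsAllClasses {s : ℕ} (F : Fin s → MvPolynomial (Fin n) K) (R : Set (TermOrder n)) : Prop :=
  ∀ o : TermOrder n, ∃ o' ∈ R, TermOrder.Equivalent F o o'

end Groebner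

/-! ## Newton polyhedra and the algorithm `TestUAGB` -/

section Algorithm

variable {K : Type*} [Field K] [Valued K ℤᵐ⁰] {n s : ℕ}

/-- The Newton polyhedron of `f`: the convex hull of the points `(val c, α)`, for `c X^α` a term
of `f`, translated by the half-line `ℝ₊ (1, 0, …, 0)`. -/
def newtonPolyhedron (f : MvPolynomial (Fin n) K) : Set (ℝ × (Fin n → ℝ)) :=
  convexHull ℝ ((fun α : Fin n →₀ ℕ => ((val (f.coeff α) : ℝ), fun j => (α j : ℝ))) '' f.support
    + (fun t : ℝ => (t, (0 : Fin n → ℝ))) '' Set.Ici 0)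

/-- The Minkowski sum of the Newton polyhedra of the `f_i`. -/
def newtonPolyhedronSum (F : Fin s → MvPolynomial (Fin n) K) : Set (ℝ × (Fin n → ℝ)) :=
  ∑ i, newtonPolyhedron (F i)

/-- The vertices of the polyhedron. -/
def newtonVertices (F : Fin s → MvPolynomial (Fin n) K) : Set (ℝ × (Fin n → ℝ)) :=
  (newtonPolyhedronSum F).extremePoints ℝ

/-- The scalar product of `p` with `U = (1, u)`. -/
def dotU (u : Fin n → ℚ) (p : ℝ × (Fin n → ℝ)) : ℝ :=
  p.1 + ∑ j, (u j : ℝ) * p.2 j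

/-- `U = (1, u)` characterizes `β`: its scalar product with the points of the polyhedron has
its unique minimum at `β`. -/
def Characterizes (F : Fin s → MvPolynomial (Fin n) K) (β : ℝ × (Fin n → ℝ)) (u : Fin n → ℚ) :
    Prop :=
  β ∈ newtonPolyhedronSum F ∧ ∀ p ∈ newtonPolyhedronSum F, p ≠ β → dotU u β < dotU u p

/-- `g` is reducible modulo `F`: it is zero, or its leading term is divisible by that of
some `f_i`. -/
def TermOrder.Reducible (o : TermOrder n) (F : Fin s → MvPolynomial (Fin n) K)
    (g : MvPolynomial (Fin n) K) : Prop :=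
  g = 0 ∨ ∃ i, o.leadingTerm (F i : MvPowerSeries (Fin n) K) ∣
    o.leadingTerm (g : MvPowerSeries (Fin n) K)

/-- The loop of `TestUAGB` over a list of vertices, with its possible outputs: `none` stands for
`True`, and `some r` for `(False, r)`. At a vertex `β` the algorithm picks some `U = (1, u)`
characterizing `β`, passes to the log-radii `r = -u` (the scalar product of `(1, u)` with
`(val c, α)` is the Gauss valuation of `c X^α` for the log-radii `-u`), computes some finite
`r`-local Gröbner basis `G` of `⟨F⟩`, and stops if an element of `G` is not reducible. -/
inductive TestLoop (m : MonomialOrder.{0, 0} (Fin n)) (F : Fin s → MvPolynomial (Fin n) K) :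
    List (ℝ × (Fin n → ℝ)) → Option (Fin n → ℚ) → Prop
  | done : TestLoop m F [] none
  | fail (β : ℝ × (Fin n → ℝ)) (l : List (ℝ × (Fin n → ℝ))) (u : Fin n → ℚ)
      (G : Finset (MvPolynomial (Fin n) K))
      (hu : Characterizes F β u)
      (hG : TermOrder.IsLocalGB ⟨-u, m⟩ (Ideal.span (Set.range F)) (G : Set _))
      (hred : ∃ g ∈ G, ¬ TermOrder.Reducible ⟨-u, m⟩ F g) :
      TestLoop m F (β :: l) (some (-u))
  | next (β : ℝ × (Fin n → ℝ)) (l : List (ℝ × (Fin n → ℝ))) (u : Fin n → ℚ)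
      (G : Finset (MvPolynomial (Fin n) K)) (out : Option (Fin n → ℚ))
      (hu : Characterizes F β u)
      (hG : TermOrder.IsLocalGB ⟨-u, m⟩ (Ideal.span (Set.range F)) (G : Set _))
      (hred : ∀ g ∈ G, TermOrder.Reducible ⟨-u, m⟩ F g)
      (hrest : TestLoop m F l out) :
      TestLoop m F (β :: l) out

/-- `out` is the output of some run of `TestUAGB` on `F`: the loop runs once through each vertex
of the polyhedron, in some order. -/
def TestUAGB (m : MonomialOrder.{0, 0} (Fin n)) (F : Fin s → MvPolynomial (Fin n) K)
    (out : Option (Fin n → ℚ)) : Prop :=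
  ∃ l : List (ℝ × (Fin n → ℝ)), l.Nodup ∧ (∀ β, β ∈ l ↔ β ∈ newtonVertices F) ∧ TestLoop m F l out

end Algorithm

end TateGB

end

/-! Everything rests on one invariance: whether `F` is a local Gröbner basis depends only on the
leading terms that the order selects in `F` (`TermOrder.Equivalent.isLocalGB`). By density of `I` in
`I_r`, only polynomials of `I` need testing (`TermOrder.isLocalGB_iff`). Suppose `F` is a Gröbner
basis for `o'`, but some `f₀` in `I` has an `o`-leading exponent `e` divisible by no leading
exponent of `F`. Top-reduce `f₀` by `F` with respect to `o'`. Equal leading terms ensure that each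
step is harmless for `o`: the leading exponent stays `e`, and its coefficient keeps its valuation.
So the `o'`-leading term, though strictly decreasing, never falls below a fixed term. Gauss
valuations have bounded denominators and monomial orders are well-founded, so the descent must stop,
yet it can always continue.

The rest is convex geometry over the rationals. A separation argument in a cone
(`exists_pos_functional_of_mem_cone`) shows that every order is equivalent to one whose radii alone
select the leading terms (`TermOrder.exists_strict_radii`), which makes the tie-break irrelevant and
gives (1). It also shows that every vertex of the Newton polyhedron is the unique minimum of some
rational `(1, u)` (`exists_characterizes`). A unique minimum on a Minkowski sum is a unique minimum
on each summand (`characterizes_newtonPoint_iff`), so the vertices represent all equivalence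
classes, which gives (2). -/

noncomputable section

namespace TateGB

/-! ### Ultrametric inequalities for the additive valuation. -/

section Valuation

variable {K : Type*} [Field K] [Valued K ℤᵐ⁰]

theorem val_add_of_ne_zero {a b : K} (h : a + b ≠ 0) :
    (a ≠ 0 ∧ val a ≤ val (a + b)) ∨ (b ≠ 0 ∧ val b ≤ val (a + b)) := by
  obtain ⟨x, -, hx0, hx⟩ := exists_val_le_val_sum (Finset.univ : Finset Bool)
    (fun x => if x then a else b) (by simpa using h)
  cases x
  · right
    simpa using And.intro hx0 hx
  · left
    simpa using And.intro hx0 hx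

/-- The comparison is required only for nonzero `b` because `val 0` is the default value `0`, not
`∞`. -/
theorem val_add_eq_of_lt {a b : K} (ha : a ≠ 0) (h : b ≠ 0 → val a < val b) :
    a + b ≠ 0 ∧ val (a + b) = val a := by
  rcases eq_or_ne b 0 with rfl | hb
  · simpa using ha
  have ha' : (Valued.v a : ℤᵐ⁰) ≠ 0 := (Valuation.ne_zero_iff _).2 ha
  have hb' : (Valued.v b : ℤᵐ⁰) ≠ 0 := (Valuation.ne_zero_iff _).2 hb
  have hlt : Valued.v b < (Valued.v a : ℤᵐ⁰) := by
    have := h hb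
    unfold val at this
    exact (WithZero.log_lt_log hb' ha').1 (by linarith)
  have heq := Valuation.map_add_eq_of_lt_left _ hlt
  refine ⟨fun h0 => ha' ?_, by rw [val, val, heq]⟩
  rw [← heq, h0, map_zero]

end Valuation

/-! ### Terms compared through a linear order. -/

section Keys

variable {K : Type*} [Field K] [Valued K ℤᵐ⁰] {n : ℕ}

theorem termVal_add_mul (r : Fin n → ℚ) (i j : Fin n →₀ ℕ) {a b : K} (ha : a ≠ 0) (hb : b ≠ 0) :
    termVal r (i + j) (a * b) = termVal r i a + termVal r j b := by
  unfold termVal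
  rw [val_mul ha hb]
  simp only [Finsupp.add_apply, Nat.cast_add, mul_add, Finset.sum_add_distrib, Int.cast_add]
  ring

theorem termVal_congr (r : Fin n → ℚ) (i : Fin n →₀ ℕ) {a b : K} (h : val a = val b) :
    termVal r i a = termVal r i b := by
  rw [termVal, termVal, h]

theorem termVal_le_termVal_iff (r : Fin n → ℚ) (i : Fin n →₀ ℕ) {a b : K} :
    termVal r i a ≤ termVal r i b ↔ val a ≤ val b := by
  simp [termVal]

theorem termVal_lt_termVal_iff (r : Fin n → ℚ) (i : Fin n →₀ ℕ) {a b : K} :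
    termVal r i a < termVal r i b ↔ val a < val b := by
  simp [termVal]

/-- The value group is `ℤ` and the radii have a common denominator, so Gauss valuations form a
discrete set. This is what makes the descent in `TermOrder.Equivalent.isLocalGB` terminate. -/
theorem exists_termVal_denominator (r : Fin n → ℚ) :
    ∃ D : ℕ, 0 < D ∧ ∀ (i : Fin n →₀ ℕ) (a : K), ∃ z : ℤ, (D : ℚ) * termVal r i a = z := by
  refine ⟨∏ j, (r j).den, Finset.prod_pos fun j _ => (r j).den_pos, fun i a => ?_⟩
  have hj : ∀ j, ∃ z : ℤ, ((∏ l, (r l).den : ℕ) : ℚ) * r j = z := by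
    intro j
    obtain ⟨c, hc⟩ := Finset.dvd_prod_of_mem (fun l => (r l).den) (Finset.mem_univ j)
    refine ⟨c * (r j).num, ?_⟩
    rw [hc]
    push_cast
    rw [mul_right_comm, mul_comm ((r j).den : ℚ), Rat.mul_den_eq_num]
    ring
  choose z hz using hj
  refine ⟨(∏ j, (r j).den : ℕ) * val a - ∑ j, z j * i j, ?_⟩
  unfold termVal
  rw [mul_sub, Finset.mul_sum]
  push_cast at hz ⊢
  congr 1
  refine Finset.sum_congr rfl fun j _ => ?_
  rw [← hz j]
  ring

/-- The position of the term `a X^i` in the linear order refining the Gauss valuation. -/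
def TermOrder.key (o : TermOrder n) (i : Fin n →₀ ℕ) (a : K) : ℚᵒᵈ ×ₗ o.tieBreak.syn :=
  toLex (OrderDual.toDual (termVal o.radii i a), o.tieBreak.toSyn i)

theorem TermOrder.key_lt_key (o : TermOrder n) {i j : Fin n →₀ ℕ} {a b : K} :
    o.key i a < o.key j b ↔ o.termLT i a j b := by
  unfold TermOrder.key TermOrder.termLT
  rw [Prod.Lex.toLex_lt_toLex]
  simp

theorem TermOrder.key_congr (o : TermOrder n) (i : Fin n →₀ ℕ) {a b : K} (h : val a = val b) :
    o.key i a = o.key i b := by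
  rw [key, key, termVal_congr _ _ h]

theorem TermOrder.key_le_key_of_val_le (o : TermOrder n) (i : Fin n →₀ ℕ) {a b : K}
    (h : val b ≤ val a) : o.key i a ≤ o.key i b := by
  refine not_lt.1 fun hlt => ?_
  rw [o.key_lt_key, TermOrder.termLT, termVal_lt_termVal_iff] at hlt
  rcases hlt with h' | ⟨-, h'⟩
  · omega
  · exact lt_irrefl _ h'

theorem TermOrder.val_lt_of_key_lt (o : TermOrder n) {i : Fin n →₀ ℕ} {a b : K}
    (h : o.key i a < o.key i b) : val b < val a := by
  by_contra! hle
  exact absurd (o.key_le_key_of_val_le i hle) (not_le.2 h)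

theorem TermOrder.eq_of_key_eq (o : TermOrder n) {i j : Fin n →₀ ℕ} {a b : K}
    (h : o.key i a = o.key j b) : i = j :=
  o.tieBreak.toSyn.injective (congrArg (fun x => (ofLex x).2) h)

theorem TermOrder.termVal_le_of_key_le (o : TermOrder n) {i j : Fin n →₀ ℕ} {a b : K}
    (h : o.key i a ≤ o.key j b) : termVal o.radii j b ≤ termVal o.radii i a := by
  by_contra! hlt
  exact absurd (o.key_lt_key.2 (Or.inl hlt)) (not_lt.2 h)

theorem TermOrder.key_mul_lt (o : TermOrder n) {i j : Fin n →₀ ℕ} {a b : K} (k : Fin n →₀ ℕ)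
    {c : K} (ha : a ≠ 0) (hb : b ≠ 0) (hc : c ≠ 0) (h : o.key i a < o.key j b) :
    o.key (k + i) (c * a) < o.key (k + j) (c * b) := by
  rw [o.key_lt_key] at h ⊢
  unfold TermOrder.termLT at h ⊢
  rw [termVal_add_mul _ _ _ hc ha, termVal_add_mul _ _ _ hc hb, map_add, map_add]
  rcases h with h | ⟨h, h'⟩
  · left
    linarith
  · exact Or.inr ⟨by rw [h], by gcongr⟩

theorem TermOrder.key_add_lt (o : TermOrder n) {i : Fin n →₀ ℕ} {a b : K}
    {κ : ℚᵒᵈ ×ₗ o.tieBreak.syn} (ha : a ≠ 0 → o.key i a < κ) (hb : b ≠ 0 → o.key i b < κ)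
    (h : a + b ≠ 0) : o.key i (a + b) < κ := by
  rcases val_add_of_ne_zero h with ⟨h0, hle⟩ | ⟨h0, hle⟩
  · exact (o.key_le_key_of_val_le i hle).trans_lt (ha h0)
  · exact (o.key_le_key_of_val_le i hle).trans_lt (hb h0)

end Keys

/-! ### Leading exponents and divisibility of leading terms. -/

section LeadingExponents

variable {K : Type*} [Field K] [Valued K ℤᵐ⁰] {n : ℕ} {o : TermOrder n}

theorem TermOrder.IsLeadingExp.key_lt {f : MvPowerSeries (Fin n) K} {e d : Fin n →₀ ℕ}
    (h : o.IsLeadingExp f e) (hd : d ≠ e) (h0 : MvPowerSeries.coeff d f ≠ 0) :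
    o.key d (MvPowerSeries.coeff d f) < o.key e (MvPowerSeries.coeff e f) :=
  o.key_lt_key.2 (h.2 d hd h0)

theorem TermOrder.IsLeadingExp.key_le {f : MvPowerSeries (Fin n) K} {e d : Fin n →₀ ℕ}
    (h : o.IsLeadingExp f e) (h0 : MvPowerSeries.coeff d f ≠ 0) :
    o.key d (MvPowerSeries.coeff d f) ≤ o.key e (MvPowerSeries.coeff e f) := by
  rcases eq_or_ne d e with rfl | hd
  · exact le_rfl
  · exact (h.key_lt hd h0).le

theorem TermOrder.IsLeadingExp.unique {f : MvPowerSeries (Fin n) K} {e d : Fin n →₀ ℕ}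
    (he : o.IsLeadingExp f e) (hd : o.IsLeadingExp f d) : e = d := by
  by_contra hne
  exact lt_asymm (he.key_lt (Ne.symm hne) hd.1) (hd.key_lt hne he.1)

theorem TermOrder.IsLeadingExp.leadingTerm_eq {f : MvPowerSeries (Fin n) K} {e : Fin n →₀ ℕ}
    (h : o.IsLeadingExp f e) :
    o.leadingTerm f = MvPolynomial.monomial e (MvPowerSeries.coeff e f) := by
  have hex : ∃ e, o.IsLeadingExp f e := ⟨e, h⟩
  rw [leadingTerm, dif_pos hex, ← h.unique hex.choose_spec]

theorem TermOrder.IsLeadingExp.leadingTerm_ne_zero {f : MvPowerSeries (Fin n) K}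
    {e : Fin n →₀ ℕ} (h : o.IsLeadingExp f e) : o.leadingTerm f ≠ 0 := by
  rw [h.leadingTerm_eq, Ne, MvPolynomial.monomial_eq_zero]
  exact h.1

theorem TermOrder.exists_isLeadingExp_of_leadingTerm_ne_zero {f : MvPowerSeries (Fin n) K}
    (h : o.leadingTerm f ≠ 0) : ∃ e, o.IsLeadingExp f e := by
  by_contra hex
  exact h (by rw [leadingTerm, dif_neg hex])

theorem TermOrder.leadingTerm_zero : o.leadingTerm (0 : MvPowerSeries (Fin n) K) = 0 := by
  by_contra h
  obtain ⟨e, he⟩ := exists_isLeadingExp_of_leadingTerm_ne_zero h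
  exact he.1 (map_zero _)

/-- Nonzero coefficients are units, so only exponents matter; a zero leading term divides no nonzero
one. -/
theorem TermOrder.leadingTerm_dvd_iff {f g : MvPowerSeries (Fin n) K} {e : Fin n →₀ ℕ}
    (hf : o.IsLeadingExp f e) :
    o.leadingTerm g ∣ o.leadingTerm f ↔ ∃ d, o.IsLeadingExp g d ∧ d ≤ e := by
  constructor
  · intro h
    obtain ⟨d, hd⟩ := exists_isLeadingExp_of_leadingTerm_ne_zero
      (ne_zero_of_dvd_ne_zero hf.leadingTerm_ne_zero h)
    rw [hd.leadingTerm_eq, hf.leadingTerm_eq, MvPolynomial.monomial_dvd_monomial] at h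
    exact ⟨d, hd, h.1.resolve_left hf.1⟩
  · rintro ⟨d, hd, hde⟩
    rw [hd.leadingTerm_eq, hf.leadingTerm_eq, MvPolynomial.monomial_dvd_monomial]
    exact ⟨Or.inr hde, (isUnit_iff_ne_zero.2 hd.1).dvd⟩

/-- Only finitely many terms have Gauss valuation at most that of a given one, and every other term
is smaller than it. -/
theorem IsTate.exists_isLeadingExp (o : TermOrder n) {f : MvPowerSeries (Fin n) K}
    (hf : IsTate o.radii f) (h0 : f ≠ 0) : ∃ e, o.IsLeadingExp f e := by
  obtain ⟨i, hi⟩ : ∃ i, MvPowerSeries.coeff i f ≠ 0 := by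
    by_contra! h
    exact h0 (MvPowerSeries.ext fun i => by simpa using h i)
  obtain ⟨e, he, hmax⟩ := (hf (termVal o.radii i (MvPowerSeries.coeff i f))).toFinset.exists_max_image
    (fun j => o.key j (MvPowerSeries.coeff j f)) ⟨i, by simpa using hi⟩
  simp only [Set.Finite.mem_toFinset, Set.mem_ofPred_eq] at he hmax
  refine ⟨e, he.1, fun d hd hd0 => o.key_lt_key.1 ?_⟩
  by_cases hdi : termVal o.radii d (MvPowerSeries.coeff d f) ≤
      termVal o.radii i (MvPowerSeries.coeff i f)
  · exact (hmax d ⟨hd0, hdi⟩).lt_of_ne fun h => hd (o.eq_of_key_eq h)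
  · refine lt_of_lt_of_le (o.key_lt_key.2 (Or.inl (not_le.1 hdi))) (hmax i ⟨hi, le_rfl⟩)

theorem exists_isLeadingExp_of_ne_zero (o : TermOrder n) {p : MvPolynomial (Fin n) K}
    (h0 : p ≠ 0) : ∃ e, o.IsLeadingExp (p : MvPowerSeries (Fin n) K) e :=
  (isTate_coe o.radii p).exists_isLeadingExp o (by simpa using h0)

/-- Adding a series whose terms are all smaller than the leading term of `f` changes neither the
leading exponent of `f` nor the valuation of its leading coefficient. -/
theorem TermOrder.IsLeadingExp.add {f h : MvPowerSeries (Fin n) K} {e : Fin n →₀ ℕ}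
    (hf : o.IsLeadingExp f e)
    (hh : ∀ i, MvPowerSeries.coeff i h ≠ 0 →
      o.key i (MvPowerSeries.coeff i h) < o.key e (MvPowerSeries.coeff e f)) :
    o.IsLeadingExp (f + h) e ∧
      val (MvPowerSeries.coeff e (f + h)) = val (MvPowerSeries.coeff e f) := by
  obtain ⟨hne, hval⟩ := val_add_eq_of_lt hf.1 fun h0 => o.val_lt_of_key_lt (hh e h0)
  rw [← map_add] at hne hval
  refine ⟨⟨hne, fun d hd h0 => o.key_lt_key.1 ?_⟩, hval⟩
  rw [o.key_congr e hval]
  rw [map_add] at h0 ⊢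
  exact o.key_add_lt (fun h => hf.key_lt hd h) (hh d) h0

theorem TermOrder.Equivalent.isLeadingExp {s : ℕ} {F : Fin s → MvPolynomial (Fin n) K}
    {o o' : TermOrder n} (h : TermOrder.Equivalent F o o') {i : Fin s} {e : Fin n →₀ ℕ}
    (he : o.IsLeadingExp (F i : MvPowerSeries (Fin n) K) e) :
    o'.IsLeadingExp (F i : MvPowerSeries (Fin n) K) e := by
  have hi := h i
  obtain ⟨d, hd⟩ := exists_isLeadingExp_of_leadingTerm_ne_zero (hi ▸ he.leadingTerm_ne_zero)
  rw [he.leadingTerm_eq, hd.leadingTerm_eq, MvPolynomial.monomial_eq_monomial_iff] at hi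
  rcases hi with ⟨rfl, -⟩ | ⟨h0, -⟩
  · exact hd
  · exact absurd h0 he.1

theorem TermOrder.Equivalent.symm {s : ℕ} {F : Fin s → MvPolynomial (Fin n) K}
    {o o' : TermOrder n} (h : TermOrder.Equivalent F o o') : TermOrder.Equivalent F o' o :=
  fun i => (h i).symm

theorem TermOrder.equivalent_of_isLeadingExp {s : ℕ} {F : Fin s → MvPolynomial (Fin n) K}
    {o o' : TermOrder n}
    (h : ∀ i e, o.IsLeadingExp (F i : MvPowerSeries (Fin n) K) e →
      o'.IsLeadingExp (F i : MvPowerSeries (Fin n) K) e) : TermOrder.Equivalent F o o' := by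
  intro i
  by_cases h0 : F i = 0
  · rw [h0, MvPolynomial.coe_zero, leadingTerm_zero, leadingTerm_zero]
  · obtain ⟨e, he⟩ := exists_isLeadingExp_of_ne_zero o h0
    rw [he.leadingTerm_eq, (h i e he).leadingTerm_eq]

end LeadingExponents

/-! ### Density of `I` in `I_r`, and finite local Gröbner bases. -/

section Density

variable {K : Type*} [Field K] [Valued K ℤᵐ⁰] {n : ℕ}

/-- All terms of `f` have Gauss valuation larger than `B`. -/
def GaussGT (r : Fin n → ℚ) (B : ℚ) (f : MvPowerSeries (Fin n) K) : Prop :=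
  ∀ i, MvPowerSeries.coeff i f ≠ 0 → B < termVal r i (MvPowerSeries.coeff i f)

theorem GaussGT.mono {r : Fin n → ℚ} {B C : ℚ} {f : MvPowerSeries (Fin n) K}
    (hf : GaussGT r B f) (h : C ≤ B) : GaussGT r C f :=
  fun i hi => h.trans_lt (hf i hi)

theorem gaussGT_zero (r : Fin n → ℚ) (B : ℚ) : GaussGT r B (0 : MvPowerSeries (Fin n) K) :=
  fun _ hi => absurd (map_zero _) hi

theorem GaussGT.neg {r : Fin n → ℚ} {B : ℚ} {f : MvPowerSeries (Fin n) K}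
    (hf : GaussGT r B f) : GaussGT r B (-f) := by
  intro i hi
  rw [map_neg] at hi ⊢
  rw [termVal_congr r i (val_neg _)]
  exact hf i (neg_ne_zero.1 hi)

theorem GaussGT.add {r : Fin n → ℚ} {B : ℚ} {f g : MvPowerSeries (Fin n) K}
    (hf : GaussGT r B f) (hg : GaussGT r B g) : GaussGT r B (f + g) := by
  intro i hi
  rw [map_add] at hi ⊢
  rcases val_add_of_ne_zero hi with ⟨h0, hle⟩ | ⟨h0, hle⟩
  · exact (hf i h0).trans_le ((termVal_le_termVal_iff r i).2 hle)
  · exact (hg i h0).trans_le ((termVal_le_termVal_iff r i).2 hle)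

theorem GaussGT.mul {r : Fin n → ℚ} {B C : ℚ} {f g : MvPowerSeries (Fin n) K}
    (hf : GaussGT r B f) (hg : GaussGT r C g) : GaussGT r (B + C) (f * g) := by
  classical
  intro k hk
  rw [MvPowerSeries.coeff_mul] at hk ⊢
  obtain ⟨⟨i, j⟩, hij, hne, hle⟩ := exists_val_le_val_sum _ _ hk
  rw [Finset.HasAntidiagonal.mem_antidiagonal] at hij
  have hi : MvPowerSeries.coeff i f ≠ 0 := left_ne_zero_of_mul hne
  have hj : MvPowerSeries.coeff j g ≠ 0 := right_ne_zero_of_mul hne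
  refine lt_of_lt_of_le ?_ ((termVal_le_termVal_iff r k).2 hle)
  simp only at hij
  rw [← hij, termVal_add_mul r i j hi hj]
  exact add_lt_add (hf i hi) (hg j hj)

theorem IsTate.exists_gaussGT {r : Fin n → ℚ} {f : MvPowerSeries (Fin n) K} (hf : IsTate r f) :
    ∃ B, GaussGT r B f := by
  obtain ⟨B, hB⟩ := hf.bddBelow
  exact ⟨B - 1, fun i hi => lt_of_lt_of_le (by linarith) (hB i hi)⟩

theorem IsTate.exists_polynomial_approx {r : Fin n → ℚ} {f : MvPowerSeries (Fin n) K}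
    (hf : IsTate r f) (B : ℚ) : ∃ p : MvPolynomial (Fin n) K, GaussGT r B (f - (p : MvPowerSeries (Fin n) K)) := by
  classical
  refine ⟨MvPowerSeries.truncFinset K (hf B).toFinset f, fun i hi => ?_⟩
  rw [map_sub, MvPolynomial.coeff_coe, MvPowerSeries.coeff_truncFinset] at hi ⊢
  by_cases hmem : i ∈ (hf B).toFinset
  · simp [hmem] at hi
  · rw [if_neg hmem, sub_zero] at hi ⊢
    rw [Set.Finite.mem_toFinset, Set.mem_ofPred_eq, not_and, not_le] at hmem
    exact hmem hi

theorem coe_polyToTate (r : Fin n → ℚ) (p : MvPolynomial (Fin n) K) :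
    ((polyToTate r p : tateAlgebra K r) : MvPowerSeries (Fin n) K) = p := rfl

/-- Truncating the coefficients of a combination of elements of `I` keeps it in `I`, with an error
as small as desired. -/
theorem exists_mem_ideal_approx {r : Fin n → ℚ} {I : Ideal (MvPolynomial (Fin n) K)}
    {f : tateAlgebra K r} (hf : f ∈ completedIdeal r I) (B : ℚ) :
    ∃ p ∈ I, GaussGT r B ((f : MvPowerSeries (Fin n) K) - (p : MvPowerSeries (Fin n) K)) := by
  unfold completedIdeal Ideal.map at hf
  induction hf using Submodule.span_induction generalizing B with
  | mem x hx =>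
    obtain ⟨p, hp, rfl⟩ := hx
    exact ⟨p, hp, by simpa [coe_polyToTate] using gaussGT_zero r B⟩
  | zero => exact ⟨0, I.zero_mem, by simpa using gaussGT_zero r B⟩
  | add x y _ _ hx hy =>
    obtain ⟨p, hp, hxp⟩ := hx B
    obtain ⟨q, hq, hyq⟩ := hy B
    refine ⟨p + q, I.add_mem hp hq, ?_⟩
    have := hxp.add hyq
    rwa [sub_add_sub_comm, ← MvPolynomial.coe_add] at this
  | smul a x _ hx =>
    obtain ⟨A, hA⟩ := IsTate.exists_gaussGT (r := r) a.2
    obtain ⟨p, hp, hxp⟩ := hx (B - A)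
    obtain ⟨C, hC⟩ := (isTate_coe r p).exists_gaussGT
    obtain ⟨q, hq⟩ := IsTate.exists_polynomial_approx (r := r) a.2 (B - C)
    refine ⟨q * p, I.mul_mem_left q hp, ?_⟩
    -- The error splits as `a x - q p = a (x - p) + (a - q) p`; the precisions `B - A` and `B - C`
    -- compensate for the sizes of `a` and `p`.
    have h1 := (hA.mul hxp).mono (C := B) (by linarith)
    have h2 := (hq.mul hC).mono (C := B) (by linarith)
    have h3 := h1.add h2
    convert h3 using 1
    rw [smul_eq_mul, MvPolynomial.coe_mul]
    push_cast
    ring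

/-- An approximation finer than the Gauss valuation of the leading term does not move that term. -/
theorem exists_mem_ideal_isLeadingExp {o : TermOrder n} {I : Ideal (MvPolynomial (Fin n) K)}
    {f : tateAlgebra K o.radii} (hf : f ∈ completedIdeal o.radii I) {e : Fin n →₀ ℕ}
    (he : o.IsLeadingExp (f : MvPowerSeries (Fin n) K) e) :
    ∃ p ∈ I, o.IsLeadingExp (p : MvPowerSeries (Fin n) K) e := by
  obtain ⟨p, hp, hfp⟩ := exists_mem_ideal_approx hf
    (termVal o.radii e (MvPowerSeries.coeff e (f : MvPowerSeries (Fin n) K)))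
  refine ⟨p, hp, ?_⟩
  have := (he.add (h := -((f : MvPowerSeries (Fin n) K) - (p : MvPowerSeries (Fin n) K))) fun i hi =>
    o.key_lt_key.2 (Or.inl (hfp.neg i hi))).1
  simpa using this

/-- Leading exponents of elements of `I` suffice to test local Gröbner bases. -/
theorem TermOrder.isLocalGB_iff {o : TermOrder n} {I : Ideal (MvPolynomial (Fin n) K)}
    {G : Set (MvPolynomial (Fin n) K)} (hG : G ⊆ I) :
    o.IsLocalGB I G ↔ ∀ f ∈ I, ∀ e, o.IsLeadingExp (f : MvPowerSeries (Fin n) K) e →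
      ∃ g ∈ G, ∃ d, o.IsLeadingExp (g : MvPowerSeries (Fin n) K) d ∧ d ≤ e := by
  constructor
  · rintro ⟨-, h⟩ f hf e he
    obtain ⟨_, ⟨g, hg, rfl⟩, hdvd⟩ := h (polyToTate o.radii f) (Ideal.mem_map_of_mem _ hf)
      (fun h0 => he.1 (by
        rw [← coe_polyToTate o.radii f, h0]
        exact map_zero _))
    exact ⟨g, hg, (leadingTerm_dvd_iff he).1 hdvd⟩
  · intro h
    refine ⟨?_, fun f hf h0 => ?_⟩
    · rintro _ ⟨g, hg, rfl⟩
      exact Ideal.mem_map_of_mem _ (hG hg)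
    · obtain ⟨e, he⟩ := IsTate.exists_isLeadingExp o f.2 (fun h => h0 (Subtype.ext h))
      obtain ⟨p, hp, hpe⟩ := exists_mem_ideal_isLeadingExp hf he
      obtain ⟨g, hg, hd⟩ := h p hp e hpe
      exact ⟨polyToTate o.radii g, ⟨g, hg, rfl⟩, (leadingTerm_dvd_iff he).2 hd⟩

/-- Dickson's lemma: the set of leading exponents of `I` has finitely many minimal elements, and
each exponent lies above one of them. -/
theorem TermOrder.exists_finite_isLocalGB (o : TermOrder n)
    (I : Ideal (MvPolynomial (Fin n) K)) :
    ∃ G : Finset (MvPolynomial (Fin n) K), o.IsLocalGB I (G : Set (MvPolynomial (Fin n) K)) := by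
  classical
  set E : Set (Fin n →₀ ℕ) :=
    {e | ∃ p ∈ I, o.IsLeadingExp (p : MvPowerSeries (Fin n) K) e}
  have hfin : {e | Minimal (fun x => x ∈ E) e}.Finite :=
    WellQuasiOrderedLE.finite_of_isAntichain (setOfPred_minimal_antichain _)
  have hex : ∀ e, ∃ p : MvPolynomial (Fin n) K,
      e ∈ E → p ∈ I ∧ o.IsLeadingExp (p : MvPowerSeries (Fin n) K) e := by
    intro e
    by_cases he : e ∈ E
    · obtain ⟨p, hp, hpe⟩ := he
      exact ⟨p, fun _ => ⟨hp, hpe⟩⟩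
    · exact ⟨0, fun h => absurd h he⟩
  choose p hp using hex
  refine ⟨hfin.toFinset.image p, (isLocalGB_iff ?_).2 fun f hf e he => ?_⟩
  · intro g hg
    simp only [Finset.coe_image, Set.Finite.coe_toFinset, Set.mem_image, Set.mem_ofPred_eq] at hg
    obtain ⟨e, he, rfl⟩ := hg
    exact (hp e he.1).1
  · obtain ⟨d, hde, hd⟩ := (Set.isPWO_of_wellQuasiOrderedLE E).exists_le_minimal
      (a := e) ⟨f, hf, he⟩
    exact ⟨p d, by simpa using ⟨d, hd, rfl⟩, d, (hp d hd.1).2, hde⟩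

end Density

/-! ### Invariance of local Gröbner bases under equivalence of orders. -/

section Invariance

variable {K : Type*} [Field K] [Valued K ℤᵐ⁰] {n : ℕ} {o : TermOrder n}

theorem TermOrder.IsLeadingExp.key_monomial_mul_le {f : MvPowerSeries (Fin n) K}
    {e : Fin n →₀ ℕ} (hf : o.IsLeadingExp f e) (k : Fin n →₀ ℕ) {c : K} {x : Fin n →₀ ℕ}
    (h : MvPowerSeries.coeff x (MvPowerSeries.monomial k c * f) ≠ 0) :
    o.key x (MvPowerSeries.coeff x (MvPowerSeries.monomial k c * f)) ≤
      o.key (k + e) (c * MvPowerSeries.coeff e f) := by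
  rw [MvPowerSeries.coeff_monomial_mul] at h ⊢
  split_ifs at h ⊢ with hk
  · obtain ⟨y, rfl⟩ := exists_add_of_le hk
    rw [add_tsub_cancel_left] at h ⊢
    rcases eq_or_ne y e with rfl | hy
    · exact le_rfl
    · exact (o.key_mul_lt k (right_ne_zero_of_mul h) hf.1 (left_ne_zero_of_mul h)
        (hf.key_lt hy (right_ne_zero_of_mul h))).le
  · exact absurd rfl h

/-- If `X^d` is divisible by the leading monomial of `g` for two term orders, with the same
leading exponent, then a top reduction of `f` modulo `g` for the second order lowers the leading
term for that order, while it keeps the leading exponent for the first one. -/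
theorem exists_top_reduction {o o' : TermOrder n} {f g : MvPolynomial (Fin n) K}
    {e d a : Fin n →₀ ℕ}
    (hfe : o.IsLeadingExp (f : MvPowerSeries (Fin n) K) e)
    (hfd : o'.IsLeadingExp (f : MvPowerSeries (Fin n) K) d) (hde : d ≠ e)
    (hg : o.IsLeadingExp (g : MvPowerSeries (Fin n) K) a)
    (hg' : o'.IsLeadingExp (g : MvPowerSeries (Fin n) K) a) (had : a ≤ d) :
    ∃ q : MvPolynomial (Fin n) K,
      o.IsLeadingExp ((f + q * g : MvPolynomial (Fin n) K) : MvPowerSeries (Fin n) K) e ∧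
      val ((f + q * g).coeff e) = val (f.coeff e) ∧
      ∀ x, (f + q * g).coeff x ≠ 0 →
        o'.key x ((f + q * g).coeff x) < o'.key d (f.coeff d) := by
  obtain ⟨k, rfl⟩ := exists_add_of_le had
  have hga : g.coeff a ≠ 0 := by simpa using hg.1
  -- This multiplier makes `c X^k g` cancel the term of `f` at `d = a + k`.
  set c : K := -(f.coeff (a + k) / g.coeff a) with hc
  have hca : c * MvPowerSeries.coeff a (g : MvPowerSeries (Fin n) K) = -f.coeff (a + k) := by
    rw [MvPolynomial.coeff_coe, hc]
    field_simp
  have hcoe : ((f + MvPolynomial.monomial k c * g : MvPolynomial (Fin n) K) :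
      MvPowerSeries (Fin n) K) = (f : MvPowerSeries (Fin n) K) +
        MvPowerSeries.monomial k c * (g : MvPowerSeries (Fin n) K) := by
    rw [MvPolynomial.coe_add, MvPolynomial.coe_mul, MvPolynomial.coe_monomial]
  -- As `a` is leading for both orders, the added multiple of `g` is bounded in either order by the
  -- term of `f` at `d`; for `o` this lies strictly below the term at `e`.
  have hbound : ∀ (p : TermOrder n), p.IsLeadingExp (g : MvPowerSeries (Fin n) K) a → ∀ x,
      MvPowerSeries.coeff x (MvPowerSeries.monomial k c * (g : MvPowerSeries (Fin n) K)) ≠ 0 →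
      p.key x (MvPowerSeries.coeff x
        (MvPowerSeries.monomial k c * (g : MvPowerSeries (Fin n) K))) ≤
        p.key (a + k) (MvPowerSeries.coeff (a + k) (f : MvPowerSeries (Fin n) K)) := by
    intro p hp x hx
    refine (hp.key_monomial_mul_le k hx).trans_eq ?_
    rw [hca, add_comm, MvPolynomial.coeff_coe]
    exact p.key_congr _ (val_neg _)
  have hadd := hfe.add (h := MvPowerSeries.monomial k c * (g : MvPowerSeries (Fin n) K))
    fun x hx => (hbound o hg x hx).trans_lt (hfe.key_lt hde hfd.1)
  rw [← hcoe, MvPolynomial.coeff_coe, MvPolynomial.coeff_coe] at hadd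
  refine ⟨MvPolynomial.monomial k c, hadd.1, hadd.2, fun x hx => ?_⟩
  rw [← MvPolynomial.coeff_coe, hcoe, map_add] at hx ⊢
  rcases eq_or_ne x (a + k) with rfl | hxd
  · refine absurd ?_ hx
    rw [MvPowerSeries.coeff_monomial_mul, if_pos le_add_self, add_tsub_cancel_right, hca]
    simp
  · rw [← MvPolynomial.coeff_coe f]
    exact o'.key_add_lt (fun h => hfd.key_lt hxd h)
      (fun h => (hbound o' hg' x h).lt_of_ne fun heq => hxd (o'.eq_of_key_eq heq)) hx

/-- Being a local Gröbner basis only depends on the equivalence class of the term order. -/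
theorem TermOrder.Equivalent.isLocalGB {s : ℕ} {F : Fin s → MvPolynomial (Fin n) K}
    {o o' : TermOrder n} (heq : TermOrder.Equivalent F o o')
    (h' : o'.IsLocalGB (Ideal.span (Set.range F)) (Set.range F)) :
    o.IsLocalGB (Ideal.span (Set.range F)) (Set.range F) := by
  rw [isLocalGB_iff Ideal.subset_span] at h' ⊢
  intro f₀ hf₀ e he₀
  by_contra hno
  have hirr : ∀ i a, o.IsLeadingExp (F i : MvPowerSeries (Fin n) K) a → ¬ a ≤ e :=
    fun i a ha hae => hno ⟨F i, ⟨i, rfl⟩, a, ha, hae⟩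
  obtain ⟨D, hD0, hD⟩ := exists_termVal_denominator (K := K) o'.radii
  have hD0' : (0 : ℚ) < D := by exact_mod_cast hD0
  set V : ℚ := termVal o'.radii e (f₀.coeff e) with hV
  -- The descent measure: the scaled gap between `V` and the Gauss valuation of the `o'`-leading
  -- term, then its monomial. The gap is a natural number because `D` clears denominators and the
  -- surviving term at `e` keeps Gauss valuation `V`.
  suffices key : ∀ (p : ℕ ×ₗ o'.tieBreak.syn) (f : MvPolynomial (Fin n) K) (d : Fin n →₀ ℕ),
      f ∈ Ideal.span (Set.range F) → o.IsLeadingExp (f : MvPowerSeries (Fin n) K) e →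
      val (f.coeff e) = val (f₀.coeff e) →
      o'.IsLeadingExp (f : MvPowerSeries (Fin n) K) d →
      (((ofLex p).1 : ℕ) : ℚ) = D * V - D * termVal o'.radii d (f.coeff d) →
      (ofLex p).2 = o'.tieBreak.toSyn d → False by
    have hne : f₀ ≠ 0 := by
      rintro rfl
      exact he₀.1 (by simp)
    obtain ⟨d, hd⟩ := exists_isLeadingExp_of_ne_zero o' hne
    have hle := o'.termVal_le_of_key_le (hd.key_le he₀.1)
    rw [MvPolynomial.coeff_coe, MvPolynomial.coeff_coe, ← hV] at hle
    obtain ⟨z, hz⟩ := hD e (f₀.coeff e)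
    obtain ⟨w, hw⟩ := hD d (f₀.coeff d)
    have hwz : w ≤ z := by
      have : (w : ℚ) ≤ z := by
        rw [← hz, ← hw]
        gcongr
      exact_mod_cast this
    refine key (toLex ((z - w).toNat, o'.tieBreak.toSyn d)) f₀ d hf₀ he₀ rfl hd ?_ rfl
    rw [hV, hz, hw]
    have : ((z - w).toNat : ℤ) = z - w := Int.toNat_of_nonneg (by omega)
    exact_mod_cast this
  intro p
  induction p using WellFoundedLT.induction with
  | ind p ih =>
    intro f d hf hfe hval hfd hp1 hp2
    obtain ⟨_, ⟨i, rfl⟩, a, ha', had⟩ := h' f hf d hfd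
    have ha : o.IsLeadingExp (F i : MvPowerSeries (Fin n) K) a := heq.symm.isLeadingExp ha'
    have hde : d ≠ e := by
      rintro rfl
      exact hirr i a ha had
    obtain ⟨q, hge, hgval, hglt⟩ := exists_top_reduction hfe hfd hde ha ha' had
    set g := f + q * F i
    have hgI : g ∈ Ideal.span (Set.range F) :=
      Ideal.add_mem _ hf (Ideal.mul_mem_left _ _ (Ideal.subset_span ⟨i, rfl⟩))
    have hg0 : g ≠ 0 := by
      intro h0
      exact hge.1 (by simp [h0])
    obtain ⟨d', hd'⟩ := exists_isLeadingExp_of_ne_zero o' hg0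
    have hd0 : g.coeff d' ≠ 0 := by simpa using hd'.1
    have hlt := hglt d' hd0
    have hle := o'.termVal_le_of_key_le (hd'.key_le hge.1)
    rw [MvPolynomial.coeff_coe, MvPolynomial.coeff_coe,
      termVal_congr _ _ (hgval.trans hval), ← hV] at hle
    obtain ⟨z, hz⟩ := hD e (f₀.coeff e)
    obtain ⟨w, hw⟩ := hD d' (g.coeff d')
    have hwz : w ≤ z := by
      have : (w : ℚ) ≤ z := by
        rw [← hz, ← hw]
        gcongr
      exact_mod_cast this
    have hN : (((z - w).toNat : ℕ) : ℚ) = D * V - D * termVal o'.radii d' (g.coeff d') := by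
      rw [hV, hz, hw]
      have : ((z - w).toNat : ℤ) = z - w := Int.toNat_of_nonneg (by omega)
      exact_mod_cast this
    refine ih (toLex ((z - w).toNat, o'.tieBreak.toSyn d')) ?_ g d' hgI hge (hgval.trans hval)
      hd' hN rfl
    -- A larger Gauss valuation shrinks the integer gap; an equal one leaves a smaller monomial.
    refine Prod.Lex.lt_iff.2 ?_
    rw [o'.key_lt_key] at hlt
    rcases hlt with hlt | ⟨hlt, hsyn⟩
    · left
      have : (((z - w).toNat : ℕ) : ℚ) < (ofLex p).1 := by
        rw [hN, hp1]
        have := mul_lt_mul_of_pos_left hlt hD0'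
        linarith
      exact_mod_cast this
    · right
      refine ⟨?_, by rw [hp2]; exact hsyn⟩
      have : (((z - w).toNat : ℕ) : ℚ) = (ofLex p).1 := by
        rw [hN, hp1, hlt]
      exact_mod_cast this

end Invariance

/-! ### Separation in rational cones. -/

section Cones

/-- Finitely many vectors in a convex cone of `ℚⁿ` that does not contain the origin lie in an
open half-space. -/
theorem exists_pos_functional_of_blunt_cone {n : ℕ} (P : Set (Fin n → ℚ))
    (hadd : ∀ x ∈ P, ∀ y ∈ P, x + y ∈ P) (hsmul : ∀ c : ℚ, 0 < c → ∀ x ∈ P, c • x ∈ P)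
    (h0 : (0 : Fin n → ℚ) ∉ P) (S : Finset (Fin n → ℚ)) (hS : ∀ v ∈ S, v ∈ P) :
    ∃ w : Fin n → ℚ, ∀ v ∈ S, 0 < ∑ j, w j * v j := by
  classical
  induction n with
  | zero =>
    refine ⟨0, fun v hv => absurd (hS v hv) ?_⟩
    rwa [Subsingleton.elim v 0]
  | succ n ih =>
    set Z := (S.filter fun v => v 0 = 0).image Fin.tail
    set A := S.filter fun v => 0 < v 0 with hA
    set B := S.filter fun v => v 0 < 0 with hB
    -- Fourier–Motzkin elimination: scaled to first coordinates `1` and `-1`, a vector of `A` and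
    -- one of `B` add up to a vector of the cone with first coordinate `0`.
    set C := (A ×ˢ B).image fun p => Fin.tail ((p.1 0)⁻¹ • p.1 + (-(p.2 0))⁻¹ • p.2)
    obtain ⟨w, hw⟩ := ih {v | Fin.cons 0 v ∈ P}
      (fun x hx y hy => by
        have := hadd _ hx _ hy
        rw [Set.mem_ofPred_eq]
        convert this using 1
        ext j
        refine Fin.cases ?_ (fun j => ?_) j <;> simp)
      (fun c hc x hx => by
        have := hsmul c hc _ hx
        rw [Set.mem_ofPred_eq]
        convert this using 1
        ext j
        refine Fin.cases ?_ (fun j => ?_) j <;> simp)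
      (by
        simpa [show (Fin.cons 0 0 : Fin (n + 1) → ℚ) = 0 from Fin.cons_self_tail 0] using h0)
      (Z ∪ C) (by
        intro v hv
        rw [Finset.mem_union] at hv
        rcases hv with hv | hv
        · obtain ⟨x, hx, rfl⟩ := Finset.mem_image.1 hv
          rw [Finset.mem_filter] at hx
          have := hS x hx.1
          rw [← Fin.cons_self_tail x, hx.2] at this
          exact this
        · obtain ⟨⟨a, b⟩, hab, rfl⟩ := Finset.mem_image.1 hv
          rw [Finset.mem_product, Finset.mem_filter, Finset.mem_filter] at hab
          obtain ⟨⟨ha, ha0⟩, hb, hb0⟩ := hab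
          simp only at ha ha0 hb hb0
          have := hadd _ (hsmul _ (inv_pos.2 ha0) _ (hS a ha)) _
            (hsmul _ (inv_pos.2 (neg_pos.2 hb0)) _ (hS b hb))
          rw [← Fin.cons_self_tail (_ + _)] at this
          convert this using 2
          simp [ha0.ne', inv_neg, hb0.ne])
    set L : (Fin (n + 1) → ℚ) → ℚ := fun v => ∑ j : Fin n, w j * v j.succ with hL
    have hAB : ∀ a ∈ A, ∀ b ∈ B, -(L a / a 0) < -(L b / b 0) := by
      intro a ha b hb
      have := hw _ (Finset.mem_union_right _ (Finset.mem_image_of_mem _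
        (Finset.mk_mem_product ha hb)))
      have h2 : ∑ j : Fin n, w j * Fin.tail ((a 0)⁻¹ • a + (-(b 0))⁻¹ • b) j =
          L a / a 0 - L b / b 0 := by
        simp only [Fin.tail, Pi.add_apply, Pi.smul_apply, smul_eq_mul, hL, div_eq_mul_inv,
          Finset.sum_mul, ← Finset.sum_sub_distrib]
        refine Finset.sum_congr rfl fun j _ => ?_
        rw [inv_neg]
        ring
      rw [h2] at this
      linarith
    -- The first coefficient `t` is bounded below by the vectors of `A` and above by those of `B`;
    -- positivity on `C` says that these bounds are compatible.
    obtain ⟨t, htA, htB⟩ : ∃ t : ℚ, (∀ a ∈ A, -(L a / a 0) < t) ∧ ∀ b ∈ B, t < -(L b / b 0) := by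
      obtain ⟨t, h1, h2⟩ := Order.exists_between_finsets (A.image fun a => -(L a / a 0))
        (B.image fun b => -(L b / b 0)) (by
          intro x hx y hy
          obtain ⟨a, ha, rfl⟩ := Finset.mem_image.1 hx
          obtain ⟨b, hb, rfl⟩ := Finset.mem_image.1 hy
          exact hAB a ha b hb)
      exact ⟨t, fun a ha => h1 _ (Finset.mem_image_of_mem _ ha),
        fun b hb => h2 _ (Finset.mem_image_of_mem _ hb)⟩
    refine ⟨Fin.cons t w, fun v hv => ?_⟩
    rw [Fin.sum_univ_succ]
    simp only [Fin.cons_zero, Fin.cons_succ]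
    change 0 < t * v 0 + L v
    rcases lt_trichotomy (v 0) 0 with h | h | h
    · have := htB v (Finset.mem_filter.2 ⟨hv, h⟩)
      have := mul_lt_mul_of_neg_right this h
      rw [neg_mul, div_mul_cancel₀ _ h.ne] at this
      linarith
    · rw [h, mul_zero, zero_add]
      exact hw _ (Finset.mem_union_left _ (Finset.mem_image_of_mem _
        (Finset.mem_filter.2 ⟨hv, h⟩)))
    · have := htA v (Finset.mem_filter.2 ⟨hv, h⟩)
      have := mul_lt_mul_of_pos_right this h
      rw [neg_mul, div_mul_cancel₀ _ h.ne'] at this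
      linarith

/-- Adding `(1, 0)` to the finite set forces the first coefficient of the functional to be positive,
so it can be normalized to `1`. -/
theorem exists_pos_functional_of_mem_cone {n : ℕ} (P : Set (ℚ × (Fin n → ℚ)))
    (hadd : ∀ x ∈ P, ∀ y ∈ P, x + y ∈ P) (hsmul : ∀ c : ℚ, 0 < c → ∀ x ∈ P, c • x ∈ P)
    (h0 : (0 : ℚ × (Fin n → ℚ)) ∉ P) (h1 : ((1, 0) : ℚ × (Fin n → ℚ)) ∈ P)
    (S : Finset (ℚ × (Fin n → ℚ))) (hS : ∀ v ∈ S, v ∈ P) :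
    ∃ u : Fin n → ℚ, ∀ v ∈ S, 0 < v.1 + ∑ j, u j * v.2 j := by
  classical
  obtain ⟨w, hw⟩ := exists_pos_functional_of_blunt_cone
    {v : Fin (n + 1) → ℚ | ((v 0, Fin.tail v) : ℚ × (Fin n → ℚ)) ∈ P}
    (fun x hx y hy => hadd _ hx _ hy) (fun c hc x hx => hsmul c hc _ hx) h0
    ((insert (1, 0) S).image fun v : ℚ × (Fin n → ℚ) => (Fin.cons v.1 v.2 : Fin (n + 1) → ℚ))
    (by
      intro v hv
      obtain ⟨x, hx, rfl⟩ := Finset.mem_image.1 hv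
      rcases Finset.mem_insert.1 hx with rfl | hx
      · simpa using h1
      · simpa using hS x hx)
  have hw' : ∀ v ∈ insert (1, 0) S, 0 < w 0 * v.1 + ∑ j : Fin n, w j.succ * v.2 j := by
    intro v hv
    have := hw _ (Finset.mem_image_of_mem _ hv)
    rwa [Fin.sum_univ_succ] at this
  have hw0 : 0 < w 0 := by simpa using hw' (1, 0) (Finset.mem_insert_self _ _)
  refine ⟨fun j => w j.succ / w 0, fun v hv => ?_⟩
  have := div_pos (hw' v (Finset.mem_insert_of_mem hv)) hw0
  rw [add_div, mul_div_cancel_left₀ _ hw0.ne', Finset.sum_div] at this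
  simpa only [div_mul_eq_mul_div] using this

end Cones

/-! ### Perturbing the radii to remove ties. -/

section Perturbation

variable {K : Type*} [Field K] [Valued K ℤᵐ⁰] {n s : ℕ}

/-- The vectors of `ℚⁿ` that have a positive multiple of the form `x - y`, with `X^x` larger
than `X^y`. -/
def monomialCone (m : MonomialOrder.{0, 0} (Fin n)) : Set (Fin n → ℚ) :=
  {v | ∃ (N : ℕ) (x y : Fin n →₀ ℕ), 0 < N ∧ (∀ j, (N : ℚ) * v j = x j - y j) ∧
    m.toSyn y < m.toSyn x}

theorem zero_notMem_monomialCone (m : MonomialOrder.{0, 0} (Fin n)) :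
    (0 : Fin n → ℚ) ∉ monomialCone m := by
  rintro ⟨N, x, y, -, h, hlt⟩
  have : x = y := by
    ext j
    have := h j
    rw [Pi.zero_apply, mul_zero, eq_comm, sub_eq_zero] at this
    exact_mod_cast this
  exact hlt.ne (by rw [this])

theorem smul_mem_monomialCone {m : MonomialOrder.{0, 0} (Fin n)} {v : Fin n → ℚ} {c : ℚ}
    (hc : 0 < c) (hv : v ∈ monomialCone m) : c • v ∈ monomialCone m := by
  obtain ⟨N, x, y, hN, h, hlt⟩ := hv
  obtain ⟨p, hp⟩ := Int.eq_ofNat_of_zero_le (Rat.num_pos.2 hc).le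
  have hp0 : p ≠ 0 := by
    rintro rfl
    have := Rat.num_pos.2 hc
    omega
  have hcp : c * c.den = p := by
    rw [Rat.mul_den_eq_num, hp]
    simp
  refine ⟨N * c.den, p • x, p • y, Nat.mul_pos hN c.den_pos, fun j => ?_, ?_⟩
  · simp only [Nat.cast_mul, Pi.smul_apply, smul_eq_mul, Finsupp.smul_apply]
    rw [← mul_sub, ← h j, ← hcp]
    ring
  · rw [map_nsmul, map_nsmul]
    exact nsmul_lt_nsmul_right hp0 hlt

theorem add_mem_monomialCone {m : MonomialOrder.{0, 0} (Fin n)} {v w : Fin n → ℚ}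
    (hv : v ∈ monomialCone m) (hw : w ∈ monomialCone m) : v + w ∈ monomialCone m := by
  obtain ⟨N, x, y, hN, h, hlt⟩ := hv
  obtain ⟨N', x', y', hN', h', hlt'⟩ := hw
  refine ⟨N * N', N' • x + N • x', N' • y + N • y', Nat.mul_pos hN hN', fun j => ?_, ?_⟩
  · simp only [Nat.cast_mul, Pi.add_apply, smul_eq_mul, Finsupp.smul_apply, Finsupp.add_apply,
      Nat.cast_add]
    linear_combination (N' : ℚ) * h j + (N : ℚ) * h' j
  · rw [map_add, map_add, map_nsmul, map_nsmul, map_nsmul, map_nsmul]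
    exact add_lt_add (nsmul_lt_nsmul_right hN'.ne' hlt) (nsmul_lt_nsmul_right hN.ne' hlt')

/-- The log-radii of a term order can be perturbed so that each leading term of `F` becomes the
only term of least Gauss valuation. -/
theorem TermOrder.exists_strict_radii (o : TermOrder n) (F : Fin s → MvPolynomial (Fin n) K) :
    ∃ r : Fin n → ℚ, ∀ i e, o.IsLeadingExp (F i : MvPowerSeries (Fin n) K) e →
      ∀ d ∈ (F i).support, d ≠ e →
        termVal r e ((F i).coeff e) < termVal r d ((F i).coeff d) := by
  classical
  -- The cone encodes `<_{r,m}`: a larger Gauss valuation comes first, then the monomial comparison.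
  -- A functional `(1, u)` positive on the relevant differences turns this lexicographic test into a
  -- single inequality.
  set P : Set (ℚ × (Fin n → ℚ)) := {p | 0 < p.1 ∨ (p.1 = 0 ∧ p.2 ∈ monomialCone o.tieBreak)}
  set S : Finset (ℚ × (Fin n → ℚ)) := Finset.univ.biUnion fun i =>
    ((F i).support ×ˢ (F i).support).image fun q =>
      (termVal o.radii q.1 ((F i).coeff q.1) - termVal o.radii q.2 ((F i).coeff q.2),
        fun j => ((q.2 j : ℚ) - q.1 j))
  obtain ⟨u, hu⟩ := exists_pos_functional_of_mem_cone P
    (by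
      rintro ⟨a, v⟩ hv ⟨b, w⟩ hw
      simp only [P, Set.mem_ofPred_eq, Prod.mk_add_mk] at hv hw ⊢
      rcases hv with hv | ⟨rfl, hv⟩ <;> rcases hw with hw | ⟨rfl, hw⟩
      · exact Or.inl (add_pos hv hw)
      · exact Or.inl (by simpa using hv)
      · exact Or.inl (by simpa using hw)
      · exact Or.inr ⟨add_zero _, add_mem_monomialCone hv hw⟩)
    (by
      rintro c hc ⟨a, v⟩ hv
      simp only [P, Set.mem_ofPred_eq, Prod.smul_mk, smul_eq_mul] at hv ⊢
      rcases hv with hv | ⟨rfl, hv⟩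
      · exact Or.inl (mul_pos hc hv)
      · exact Or.inr ⟨mul_zero _, smul_mem_monomialCone hc hv⟩)
    (by
      rintro (h | ⟨-, h⟩)
      · exact lt_irrefl _ h
      · exact zero_notMem_monomialCone _ h)
    (Or.inl one_pos) (S.filter (· ∈ P)) (fun v hv => (Finset.mem_filter.1 hv).2)
  -- Raising the radii by `u` adds `u · (e - d)` to the difference of Gauss valuations at `d` and
  -- `e`, which is the value of the functional.
  refine ⟨o.radii + u, fun i e he d hd hde => ?_⟩
  have he0 : e ∈ (F i).support := by simpa using he.1
  have hkey := he.2 d hde (by simpa using hd)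
  rw [TermOrder.termLT, MvPolynomial.coeff_coe, MvPolynomial.coeff_coe] at hkey
  have hpos := hu (termVal o.radii d ((F i).coeff d) - termVal o.radii e ((F i).coeff e),
      fun j => ((e j : ℚ) - d j)) (by
    refine Finset.mem_filter.2 ⟨Finset.mem_biUnion.2 ⟨i, Finset.mem_univ i,
      Finset.mem_image.2 ⟨(d, e), Finset.mk_mem_product hd he0, rfl⟩⟩, ?_⟩
    rcases hkey with h | ⟨h, h'⟩
    · exact Or.inl (sub_pos.2 h)
    · exact Or.inr ⟨sub_eq_zero.2 h, 1, e, d, one_pos, fun j => by simp, h'⟩)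
  simp only [mul_sub, Finset.sum_sub_distrib] at hpos
  have hsplit : ∀ (x : Fin n →₀ ℕ) (c : K), termVal (o.radii + u) x c =
      termVal o.radii x c - ∑ j, u j * (x j : ℚ) := by
    intro x c
    simp only [termVal, Pi.add_apply, add_mul, Finset.sum_add_distrib]
    ring
  rw [hsplit, hsplit]
  linarith

/-- With a strict minimum the tie-break is never consulted, so it can be exchanged for any other. -/
theorem isLeadingExp_of_strict (o : TermOrder n) {p : MvPolynomial (Fin n) K} {e : Fin n →₀ ℕ}
    (he : e ∈ p.support)
    (h : ∀ d ∈ p.support, d ≠ e → termVal o.radii e (p.coeff e) < termVal o.radii d (p.coeff d)) :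
    o.IsLeadingExp (p : MvPowerSeries (Fin n) K) e := by
  refine ⟨by simpa using he, fun d hd h0 => Or.inl ?_⟩
  rw [MvPolynomial.coeff_coe] at h0 ⊢
  rw [MvPolynomial.coeff_coe]
  exact h d (MvPolynomial.mem_support_iff.2 h0) hd

end Perturbation

/-! ### Vertices of the Newton polyhedron and the functionals that select them. -/

section Polyhedra

variable {K : Type*} [Field K] [Valued K ℤᵐ⁰] {n s : ℕ}

theorem dotU_add (u : Fin n → ℚ) (p q : ℝ × (Fin n → ℝ)) :
    dotU u (p + q) = dotU u p + dotU u q := by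
  simp only [dotU, Prod.fst_add, Prod.snd_add, Pi.add_apply, mul_add, Finset.sum_add_distrib]
  ring

theorem dotU_smul (u : Fin n → ℚ) (a : ℝ) (p : ℝ × (Fin n → ℝ)) :
    dotU u (a • p) = a * dotU u p := by
  simp only [dotU, Prod.smul_fst, Prod.smul_snd, Pi.smul_apply, smul_eq_mul, mul_add,
    Finset.mul_sum]
  congr 1
  exact Finset.sum_congr rfl fun j _ => by ring

/-- An open half-space stays convex when one boundary point is added. Hence a unique minimum on a
convex hull can be checked on generators. -/
theorem convex_setOf_eq_or_dotU_lt (u : Fin n → ℚ) (β : ℝ × (Fin n → ℝ)) :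
    Convex ℝ {p | p = β ∨ dotU u β < dotU u p} := by
  intro x hx y hy a b ha hb hab
  rw [Set.mem_ofPred_eq, dotU_add, dotU_smul, dotU_smul]
  have hβ : dotU u β = a * dotU u β + b * dotU u β := by rw [← add_mul, hab, one_mul]
  rcases hx with rfl | hx <;> rcases hy with rfl | hy
  · left
    rw [← add_smul, hab, one_smul]
  · rcases hb.eq_or_lt with rfl | hb
    · left
      rw [add_zero] at hab
      simp [hab]
    · right
      have := mul_lt_mul_of_pos_left hy hb
      linarith
  · rcases ha.eq_or_lt with rfl | ha
    · left
      rw [zero_add] at hab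
      simp [hab]
    · right
      have := mul_lt_mul_of_pos_left hx ha
      linarith
  · right
    rcases ha.eq_or_lt with rfl | ha
    · rw [zero_add] at hab
      simpa [hab] using hy
    · have h1 := mul_lt_mul_of_pos_left hx ha
      have h2 := mul_le_mul_of_nonneg_left hy.le hb
      linarith

/-- The inclusion of `ℚ^(n+1)` into `ℝ^(n+1)`. -/
def ratToReal (v : ℚ × (Fin n → ℚ)) : ℝ × (Fin n → ℝ) :=
  ((v.1 : ℝ), fun j => (v.2 j : ℝ))

theorem ratToReal_add (v w : ℚ × (Fin n → ℚ)) :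
    ratToReal (v + w) = ratToReal v + ratToReal w := by
  ext <;> simp [ratToReal]

theorem ratToReal_sub (v w : ℚ × (Fin n → ℚ)) :
    ratToReal (v - w) = ratToReal v - ratToReal w := by
  ext <;> simp [ratToReal]

theorem ratToReal_smul (c : ℚ) (v : ℚ × (Fin n → ℚ)) :
    ratToReal (c • v) = (c : ℝ) • ratToReal v := by
  ext <;> simp [ratToReal]

theorem ratToReal_zero : ratToReal (0 : ℚ × (Fin n → ℚ)) = 0 := by
  ext <;> simp [ratToReal]

theorem ratToReal_eq_zero {v : ℚ × (Fin n → ℚ)} (h : ratToReal v = 0) : v = 0 := by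
  have h1 := congrArg Prod.fst h
  have h2 := congrArg Prod.snd h
  ext j
  · simpa [ratToReal] using h1
  · simpa [ratToReal] using congrFun h2 j

theorem dotU_ratToReal (u : Fin n → ℚ) (v : ℚ × (Fin n → ℚ)) :
    dotU u (ratToReal v) = ((v.1 + ∑ j, u j * v.2 j : ℚ) : ℝ) := by
  simp [dotU, ratToReal]

/-- The sum of the points of the Newton polyhedra attached to the terms of `F i` with
exponents `α i`. -/
def newtonPoint (F : Fin s → MvPolynomial (Fin n) K) (α : Fin s → Fin n →₀ ℕ) :
    ℚ × (Fin n → ℚ) :=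
  ∑ i, ((val ((F i).coeff (α i)) : ℚ), fun j => (α i j : ℚ))

theorem dotU_newtonPoint (F : Fin s → MvPolynomial (Fin n) K) (α : Fin s → Fin n →₀ ℕ)
    (u : Fin n → ℚ) : dotU u (ratToReal (newtonPoint F α)) =
      ((∑ i, termVal (-u) (α i) ((F i).coeff (α i)) : ℚ) : ℝ) := by
  rw [dotU_ratToReal]
  congr 1
  simp only [newtonPoint, Prod.fst_sum, Prod.snd_sum, Finset.sum_apply, termVal, Pi.neg_apply,
    neg_mul, Finset.sum_neg_distrib, sub_neg_eq_add, Finset.sum_add_distrib, Finset.mul_sum]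
  rw [Finset.sum_comm]

/-- Generators of the Minkowski sum of the Newton polyhedra. -/
def newtonGenerators (F : Fin s → MvPolynomial (Fin n) K) : Set (ℝ × (Fin n → ℝ)) :=
  ∑ i, ((fun α : Fin n →₀ ℕ => ((val ((F i).coeff α) : ℝ), fun j => (α j : ℝ))) '' (F i).support
    + (fun t : ℝ => (t, (0 : Fin n → ℝ))) '' Set.Ici 0)

theorem newtonPolyhedronSum_eq (F : Fin s → MvPolynomial (Fin n) K) :
    newtonPolyhedronSum F = convexHull ℝ (newtonGenerators F) := by
  rw [newtonGenerators, convexHull_sum]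
  rfl

theorem convex_newtonPolyhedronSum (F : Fin s → MvPolynomial (Fin n) K) :
    Convex ℝ (newtonPolyhedronSum F) := by
  rw [newtonPolyhedronSum_eq]
  exact convex_convexHull _ _

theorem mem_newtonGenerators_iff (F : Fin s → MvPolynomial (Fin n) K) (p : ℝ × (Fin n → ℝ)) :
    p ∈ newtonGenerators F ↔ ∃ (α : Fin s → Fin n →₀ ℕ) (τ : Fin s → ℝ),
      (∀ i, α i ∈ (F i).support) ∧ (∀ i, 0 ≤ τ i) ∧
        p = ratToReal (newtonPoint F α) + (∑ i, τ i, 0) := by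
  have hsum : ∀ (α : Fin s → Fin n →₀ ℕ) (τ : Fin s → ℝ),
      ∑ i, ((((val ((F i).coeff (α i)) : ℝ), fun j => (α i j : ℝ)) : ℝ × (Fin n → ℝ)) +
        (τ i, 0)) = ratToReal (newtonPoint F α) + (∑ i, τ i, 0) := by
    intro α τ
    ext j
    · simp [ratToReal, newtonPoint, Prod.fst_sum, Finset.sum_add_distrib]
    · simp [ratToReal, newtonPoint, Prod.snd_sum, Finset.sum_apply]
  rw [newtonGenerators, Set.mem_fintype_sum]
  constructor
  · rintro ⟨g, hg, rfl⟩
    have : ∀ i, ∃ (a : Fin n →₀ ℕ) (t : ℝ), a ∈ (F i).support ∧ 0 ≤ t ∧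
        (((val ((F i).coeff a) : ℝ), fun j => (a j : ℝ)) : ℝ × (Fin n → ℝ)) + (t, 0) = g i := by
      intro i
      obtain ⟨_, ⟨a, ha, rfl⟩, _, ⟨t, ht, rfl⟩, h⟩ := Set.mem_add.1 (hg i)
      exact ⟨a, t, ha, ht, h⟩
    choose α τ hα hτ h using this
    exact ⟨α, τ, hα, hτ, by rw [← hsum]; exact Finset.sum_congr rfl fun i _ => (h i).symm⟩
  · rintro ⟨α, τ, hα, hτ, rfl⟩
    exact ⟨_, fun i => Set.add_mem_add ⟨α i, hα i, rfl⟩ ⟨τ i, hτ i, rfl⟩, hsum α τ⟩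

theorem newtonGenerators_subset (F : Fin s → MvPolynomial (Fin n) K) :
    newtonGenerators F ⊆ newtonPolyhedronSum F := by
  rw [newtonPolyhedronSum_eq]
  exact subset_convexHull _ _

theorem newtonPoint_mem (F : Fin s → MvPolynomial (Fin n) K) {α : Fin s → Fin n →₀ ℕ}
    (hα : ∀ i, α i ∈ (F i).support) : ratToReal (newtonPoint F α) ∈ newtonPolyhedronSum F :=
  newtonGenerators_subset F ((mem_newtonGenerators_iff F _).2
    ⟨α, 0, hα, fun _ => le_rfl, by ext <;> simp⟩)

/-- Only finitely many points need testing: moving up the half-lines strictly increases `dotU`,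
whose first coefficient is `1`. -/
theorem characterizes_of_forall_newtonPoint {F : Fin s → MvPolynomial (Fin n) K}
    {α : Fin s → Fin n →₀ ℕ} {u : Fin n → ℚ} (hα : ∀ i, α i ∈ (F i).support)
    (h : ∀ γ : Fin s → Fin n →₀ ℕ, (∀ i, γ i ∈ (F i).support) → newtonPoint F γ ≠ newtonPoint F α →
      dotU u (ratToReal (newtonPoint F α)) < dotU u (ratToReal (newtonPoint F γ))) :
    Characterizes F (ratToReal (newtonPoint F α)) u := by
  refine ⟨newtonPoint_mem F hα, fun p hp hne => ?_⟩
  have hsub : newtonPolyhedronSum F ⊆ {p | p = ratToReal (newtonPoint F α) ∨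
      dotU u (ratToReal (newtonPoint F α)) < dotU u p} := by
    rw [newtonPolyhedronSum_eq]
    refine convexHull_min (fun q hq => ?_) (convex_setOf_eq_or_dotU_lt u _)
    obtain ⟨γ, τ, hγ, hτ, rfl⟩ := (mem_newtonGenerators_iff F q).1 hq
    have hτ0 : 0 ≤ ∑ i, τ i := Finset.sum_nonneg fun i _ => hτ i
    have hdot : dotU u ((∑ i, τ i, 0) : ℝ × (Fin n → ℝ)) = ∑ i, τ i := by simp [dotU]
    rw [Set.mem_ofPred_eq, dotU_add, hdot]
    by_cases hγα : newtonPoint F γ = newtonPoint F α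
    · rw [hγα]
      rcases hτ0.eq_or_lt with h0 | h0
      · left
        rw [← h0]
        ext <;> simp
      · right
        linarith
    · right
      linarith [h γ hγ hγα]
  exact (hsub hp).resolve_left hne

theorem exists_newtonPoint_of_mem_newtonVertices {F : Fin s → MvPolynomial (Fin n) K}
    {β : ℝ × (Fin n → ℝ)} (hβ : β ∈ newtonVertices F) :
    ∃ α : Fin s → Fin n →₀ ℕ, (∀ i, α i ∈ (F i).support) ∧ β = ratToReal (newtonPoint F α) := by
  have hβT : β ∈ newtonGenerators F := by
    rw [newtonVertices, newtonPolyhedronSum_eq] at hβ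
    exact extremePoints_convexHull_subset hβ
  obtain ⟨α, τ, hα, hτ, rfl⟩ := (mem_newtonGenerators_iff F β).1 hβT
  refine ⟨α, hα, ?_⟩
  -- A generator with shift `τ` is the midpoint of those with shifts `0` and `2τ`, so an extreme one
  -- has total shift zero.
  have h2 : ratToReal (newtonPoint F α) + (∑ i, 2 * τ i, 0) ∈ newtonPolyhedronSum F :=
    newtonGenerators_subset F ((mem_newtonGenerators_iff F _).2
      ⟨α, fun i => 2 * τ i, hα, fun i => mul_nonneg two_pos.le (hτ i), rfl⟩)
  refine ((mem_extremePoints_iff_left.1 hβ).2 _ (newtonPoint_mem F hα) _ h2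
    ⟨1 / 2, 1 / 2, by norm_num, by norm_num, by norm_num, ?_⟩).symm
  rw [← Finset.mul_sum]
  ext j
  · simp
    ring
  · simp
    ring

theorem finite_newtonVertices (F : Fin s → MvPolynomial (Fin n) K) :
    (newtonVertices F).Finite := by
  classical
  refine ((Fintype.piFinset fun i => (F i).support).finite_toSet.image
    fun α => ratToReal (newtonPoint F α)).subset fun β hβ => ?_
  obtain ⟨α, hα, rfl⟩ := exists_newtonPoint_of_mem_newtonVertices hβ
  exact ⟨α, by simpa using hα, rfl⟩

/-- A convex set that contains `β + ε v` for some `ε > 0` contains it for all smaller ones. -/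
theorem add_smul_mem_of_convex {E : Type*} [AddCommGroup E] [Module ℝ E] {N : Set E}
    (hN : Convex ℝ N) {β v : E} (hβ : β ∈ N) {ε δ : ℝ} (hδ : 0 < δ) (hδε : δ ≤ ε)
    (h : β + ε • v ∈ N) : β + δ • v ∈ N := by
  have hε : 0 < ε := hδ.trans_le hδε
  have := hN.add_smul_mem hβ h (t := δ / ε) ⟨by positivity, (div_le_one hε).2 hδε⟩
  rwa [smul_smul, div_mul_cancel₀ _ hε.ne'] at this

/-- The nonzero rational directions that stay in the polyhedron for a short time from `β` form a
cone. Extremality keeps `0` out of it: opposite directions would make `β` a midpoint. Working with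
rational directions gives a rational `u`. -/
theorem exists_characterizes {F : Fin s → MvPolynomial (Fin n) K}
    {β : ℝ × (Fin n → ℝ)} (hβ : β ∈ newtonVertices F) : ∃ u, Characterizes F β u := by
  classical
  -- The empty Minkowski sum is a single point, without the direction `(1, 0)` that the cone
  -- argument needs.
  rcases Nat.eq_zero_or_pos s with rfl | hs
  · obtain ⟨α, hα, rfl⟩ := exists_newtonPoint_of_mem_newtonVertices hβ
    exact ⟨0, characterizes_of_forall_newtonPoint hα fun γ _ h =>
      absurd (congrArg _ (Subsingleton.elim γ α)) h⟩
  obtain ⟨α, hα, hβα⟩ := exists_newtonPoint_of_mem_newtonVertices hβ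
  have hN := convex_newtonPolyhedronSum F
  have hβN : β ∈ newtonPolyhedronSum F := hβ.1
  set P : Set (ℚ × (Fin n → ℚ)) :=
    {v | v ≠ 0 ∧ ∃ ε : ℝ, 0 < ε ∧ β + ε • ratToReal v ∈ newtonPolyhedronSum F}
  have hmid : ∀ v w : ℚ × (Fin n → ℚ), ∀ ε : ℝ,
      β + (ε / 2) • ratToReal (v + w) =
        (1 / 2 : ℝ) • (β + ε • ratToReal v) + (1 / 2 : ℝ) • (β + ε • ratToReal w) := by
    intro v w ε
    rw [ratToReal_add]
    module
  obtain ⟨u, hu⟩ := exists_pos_functional_of_mem_cone P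
    (by
      rintro v ⟨hv0, ε, hε, hv⟩ w ⟨hw0, δ, hδ, hw⟩
      have hm : 0 < min ε δ := lt_min hε hδ
      have hv' := add_smul_mem_of_convex hN hβN hm (min_le_left _ _) hv
      have hw' := add_smul_mem_of_convex hN hβN hm (min_le_right _ _) hw
      refine ⟨fun h0 => ?_, min ε δ / 2, half_pos hm, ?_⟩
      · have hx := hmid v w (min ε δ)
        rw [h0, ratToReal_zero, smul_zero, add_zero] at hx
        have := (mem_extremePoints_iff_left.1 hβ).2 _ hv' _ hw'
          ⟨1 / 2, 1 / 2, by norm_num, by norm_num, by norm_num, hx.symm⟩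
        rw [add_eq_left, smul_eq_zero] at this
        exact hv0 (ratToReal_eq_zero (this.resolve_left hm.ne'))
      · rw [hmid]
        exact hN hv' hw' (by norm_num) (by norm_num) (by norm_num))
    (by
      rintro c hc v ⟨hv0, ε, hε, hv⟩
      have hc' : (0 : ℝ) < c := by exact_mod_cast hc
      refine ⟨smul_ne_zero hc.ne' hv0, ε / c, div_pos hε hc', ?_⟩
      rwa [ratToReal_smul, smul_smul, div_mul_cancel₀ _ hc'.ne'])
    (fun h => h.1 rfl)
    -- The direction `(1, 0)` is realized by shifting a single summand up its half-line.
    (by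
      refine ⟨fun h => one_ne_zero (congrArg Prod.fst h), 1, one_pos,
        newtonGenerators_subset F ((mem_newtonGenerators_iff F _).2
          ⟨α, Pi.single ⟨0, hs⟩ 1, hα, fun i => ?_, ?_⟩)⟩
      · exact (Pi.single_nonneg.2 zero_le_one : (0 : Fin s → ℝ) ≤ Pi.single ⟨0, hs⟩ 1) i
      · rw [hβα, Finset.sum_pi_single', if_pos (Finset.mem_univ _)]
        ext <;> simp [ratToReal])
    (((Fintype.piFinset fun i => (F i).support).image
      fun γ => newtonPoint F γ - newtonPoint F α).filter (· ≠ 0))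
    (by
      intro v hv
      obtain ⟨hv, hv0⟩ := Finset.mem_filter.1 hv
      obtain ⟨γ, hγ, rfl⟩ := Finset.mem_image.1 hv
      refine ⟨hv0, 1, one_pos, ?_⟩
      rw [one_smul, ratToReal_sub, hβα, add_sub_cancel]
      exact newtonPoint_mem F (Fintype.mem_piFinset.1 hγ))
  refine ⟨u, hβα ▸ characterizes_of_forall_newtonPoint hα fun γ hγ hne => ?_⟩
  have := hu (newtonPoint F γ - newtonPoint F α) (Finset.mem_filter.2
    ⟨Finset.mem_image_of_mem _ (Fintype.mem_piFinset.2 hγ), sub_ne_zero.2 hne⟩)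
  rw [dotU_ratToReal, dotU_ratToReal, Rat.cast_lt, ← sub_pos]
  simp only [Prod.fst_sub, Prod.snd_sub, Pi.sub_apply, mul_sub, Finset.sum_sub_distrib] at this
  linarith

theorem Characterizes.mem_newtonVertices {F : Fin s → MvPolynomial (Fin n) K}
    {β : ℝ × (Fin n → ℝ)} {u : Fin n → ℚ} (h : Characterizes F β u) : β ∈ newtonVertices F := by
  refine mem_extremePoints_iff_left.2 ⟨h.1, fun x hx y hy hxy => ?_⟩
  by_contra hne
  obtain ⟨a, b, ha, hb, hab, heq⟩ := hxy
  have h1 := mul_lt_mul_of_pos_left (h.2 x hx hne) ha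
  have h2 : dotU u β ≤ dotU u y := by
    rcases eq_or_ne y β with rfl | hy'
    · exact le_rfl
    · exact (h.2 y hy hy').le
  have h3 := mul_le_mul_of_nonneg_left h2 hb.le
  have h4 := congrArg (dotU u) heq
  rw [dotU_add, dotU_smul, dotU_smul] at h4
  have h5 : a * dotU u β + b * dotU u β = dotU u β := by rw [← add_mul, hab, one_mul]
  linarith

theorem sum_update_sub_sum {ι A : Type*} [Fintype ι] [DecidableEq ι] (g : ι → A → ℚ) (α : ι → A)
    (i : ι) (d : A) :
    ∑ l, g l (Function.update α i d l) - ∑ l, g l (α l) = g i d - g i (α i) := by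
  rw [← Finset.sum_sub_distrib, Finset.sum_eq_single i]
  · simp
  · intro l _ hl
    simp [Function.update_of_ne hl]
  · simp

/-- Varying one exponent at a time isolates each summand; conversely, the strict inequalities of the
summands add up. Together with `isLeadingExp_of_strict`, this shows that every `u` characterizing a
vertex selects the same leading terms. -/
theorem characterizes_newtonPoint_iff {F : Fin s → MvPolynomial (Fin n) K}
    {α : Fin s → Fin n →₀ ℕ} (hα : ∀ i, α i ∈ (F i).support) (u : Fin n → ℚ) :
    Characterizes F (ratToReal (newtonPoint F α)) u ↔ ∀ i, ∀ d ∈ (F i).support, d ≠ α i →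
      termVal (-u) (α i) ((F i).coeff (α i)) < termVal (-u) d ((F i).coeff d) := by
  classical
  constructor
  · intro h i d hd hne
    have hγ : ∀ l, Function.update α i d l ∈ (F l).support := by
      intro l
      rcases eq_or_ne l i with rfl | hl
      · simpa using hd
      · simpa [Function.update_of_ne hl] using hα l
    have hpt : ratToReal (newtonPoint F (Function.update α i d)) ≠
        ratToReal (newtonPoint F α) := by
      intro heq
      rw [← sub_eq_zero, ← ratToReal_sub] at heq
      have h2 := congrArg Prod.snd (sub_eq_zero.1 (ratToReal_eq_zero heq))
      refine hne (Finsupp.ext fun j => ?_)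
      have h3 := congrFun h2 j
      simp only [newtonPoint, Prod.snd_sum, Finset.sum_apply] at h3
      have h4 := sum_update_sub_sum (fun _ (x : Fin n →₀ ℕ) => (x j : ℚ)) α i d
      rw [h3, sub_self, eq_comm, sub_eq_zero] at h4
      exact_mod_cast h4
    have hlt := h.2 _ (newtonPoint_mem F hγ) hpt
    rw [dotU_newtonPoint, dotU_newtonPoint, Rat.cast_lt, ← sub_pos,
      sum_update_sub_sum (fun l x => termVal (-u) x ((F l).coeff x)), sub_pos] at hlt
    exact hlt
  · intro h
    refine characterizes_of_forall_newtonPoint hα fun γ hγ hne => ?_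
    rw [dotU_newtonPoint, dotU_newtonPoint, Rat.cast_lt]
    have hle : ∀ i, termVal (-u) (α i) ((F i).coeff (α i)) ≤
        termVal (-u) (γ i) ((F i).coeff (γ i)) := by
      intro i
      rcases eq_or_ne (γ i) (α i) with heq | hi
      · rw [heq]
      · exact (h i _ (hγ i) hi).le
    obtain ⟨i, hi⟩ : ∃ i, γ i ≠ α i := by
      by_contra! hall
      exact hne (by rw [funext hall])
    exact Finset.sum_lt_sum (fun i _ => hle i) ⟨i, Finset.mem_univ i, h i _ (hγ i) hi⟩

end Polyhedra

/-! ### Proof of the criterion and correctness of `TestUAGB`. -/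

section Correctness

variable {K : Type*} [Field K] [Valued K ℤᵐ⁰] {n s : ℕ}

/-- Orders in `R` may carry a tie-break other than `m`; strict radii replace each by an equivalent
order with tie-break `m`. -/
theorem isUAGB_iff_of_meetsAllClasses {m : MonomialOrder.{0, 0} (Fin n)}
    {F : Fin s → MvPolynomial (Fin n) K} {R : Set (TermOrder n)} (hR : MeetsAllClasses F R) :
    IsUAGB m (Ideal.span (Set.range F)) (Set.range F) ↔
      ∀ o ∈ R, o.IsLocalGB (Ideal.span (Set.range F)) (Set.range F) := by
  constructor
  · rintro ⟨-, -, h⟩ o -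
    obtain ⟨r, hr⟩ := o.exists_strict_radii F
    have heq : TermOrder.Equivalent F o ⟨r, m⟩ :=
      TermOrder.equivalent_of_isLeadingExp fun i e he =>
        isLeadingExp_of_strict _ (by simpa using he.1) (hr i e he)
    exact heq.isLocalGB (h r)
  · refine fun h => ⟨Set.finite_range F, Ideal.subset_span, fun r => ?_⟩
    obtain ⟨o', ho', heq⟩ := hR ⟨r, m⟩
    exact heq.isLocalGB (h o' ho')

theorem exists_testLoop (m : MonomialOrder.{0, 0} (Fin n)) (F : Fin s → MvPolynomial (Fin n) K)
    (l : List (ℝ × (Fin n → ℝ))) (hl : ∀ β ∈ l, β ∈ newtonVertices F) :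
    ∃ out, TestLoop m F l out := by
  induction l with
  | nil => exact ⟨none, TestLoop.done⟩
  | cons β l ih =>
    obtain ⟨u, hu⟩ := exists_characterizes (hl β List.mem_cons_self)
    obtain ⟨G, hG⟩ := TermOrder.exists_finite_isLocalGB ⟨-u, m⟩ (Ideal.span (Set.range F))
    by_cases hred : ∃ g ∈ G, ¬ TermOrder.Reducible ⟨-u, m⟩ F g
    · exact ⟨_, TestLoop.fail β l u G hu hG hred⟩
    · push Not at hred
      obtain ⟨out, hout⟩ := ih fun γ hγ => hl γ (List.mem_cons_of_mem _ hγ)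
      exact ⟨out, TestLoop.next β l u G out hu hG hred hout⟩

theorem TermOrder.IsLocalGB.reducible {o : TermOrder n} {F : Fin s → MvPolynomial (Fin n) K}
    {G : Set (MvPolynomial (Fin n) K)} (hG : o.IsLocalGB (Ideal.span (Set.range F)) G)
    (hF : o.IsLocalGB (Ideal.span (Set.range F)) (Set.range F)) {g : MvPolynomial (Fin n) K}
    (hg : g ∈ G) : o.Reducible F g := by
  rcases eq_or_ne g 0 with rfl | h0
  · exact Or.inl rfl
  obtain ⟨_, ⟨_, ⟨i, rfl⟩, rfl⟩, hdvd⟩ := hF.2 (polyToTate o.radii g) (hG.1 ⟨g, hg, rfl⟩)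
    fun h => h0 (by
      rw [← MvPolynomial.coe_eq_zero_iff, ← coe_polyToTate o.radii, h]
      rfl)
  exact Or.inr ⟨i, hdvd⟩

theorem TermOrder.IsLocalGB.of_reducible {o : TermOrder n} {F : Fin s → MvPolynomial (Fin n) K}
    {G : Set (MvPolynomial (Fin n) K)} (hG : o.IsLocalGB (Ideal.span (Set.range F)) G)
    (hred : ∀ g ∈ G, o.Reducible F g) :
    o.IsLocalGB (Ideal.span (Set.range F)) (Set.range F) := by
  refine ⟨?_, fun f hf h0 => ?_⟩
  · rintro _ ⟨g, hg, rfl⟩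
    exact Ideal.mem_map_of_mem _ (Ideal.subset_span hg)
  · obtain ⟨_, ⟨g, hg, rfl⟩, hdvd⟩ := hG.2 f hf h0
    -- Zero counts as reducible, but its leading term divides none of the nonzero leading terms, so
    -- it is never the witness.
    rcases hred g hg with rfl | ⟨i, hi⟩
    · rw [coe_polyToTate, MvPolynomial.coe_zero, leadingTerm_zero, zero_dvd_iff] at hdvd
      obtain ⟨e, he⟩ := IsTate.exists_isLeadingExp o f.2 (fun h => h0 (Subtype.ext h))
      exact absurd hdvd he.leadingTerm_ne_zero
    · exact ⟨_, ⟨F i, ⟨i, rfl⟩, rfl⟩, hi.trans hdvd⟩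

theorem TestLoop.not_isLocalGB {m : MonomialOrder.{0, 0} (Fin n)}
    {F : Fin s → MvPolynomial (Fin n) K} {l : List (ℝ × (Fin n → ℝ))} {r : Fin n → ℚ}
    (h : TestLoop m F l (some r)) :
    ¬ TermOrder.IsLocalGB ⟨r, m⟩ (Ideal.span (Set.range F)) (Set.range F) := by
  generalize hout : some r = out at h
  induction h with
  | done => cases hout
  | fail β l u G hu hG hred =>
    cases hout
    obtain ⟨g, hg, hgred⟩ := hred
    exact fun hF => hgred (hG.reducible hF hg)
  | next β l u G out hu hG hred hrest ih => exact ih hout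

theorem TestLoop.exists_isLocalGB {m : MonomialOrder.{0, 0} (Fin n)}
    {F : Fin s → MvPolynomial (Fin n) K} {l : List (ℝ × (Fin n → ℝ))}
    (h : TestLoop m F l none) {β : ℝ × (Fin n → ℝ)} (hβ : β ∈ l) :
    ∃ u, Characterizes F β u ∧
      TermOrder.IsLocalGB ⟨-u, m⟩ (Ideal.span (Set.range F)) (Set.range F) := by
  generalize hout : none = out at h
  induction h with
  | done => cases hβ
  | fail => cases hout
  | next γ l u G out hu hG hred hrest ih =>
    rcases List.mem_cons.1 hβ with rfl | hβ
    · exact ⟨u, hu, hG.of_reducible hred⟩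
    · exact ih hβ hout

theorem exists_testUAGB (m : MonomialOrder.{0, 0} (Fin n))
    (F : Fin s → MvPolynomial (Fin n) K) : ∃ out, TestUAGB m F out := by
  classical
  have hmem : ∀ β, β ∈ (finite_newtonVertices F).toFinset.toList ↔ β ∈ newtonVertices F := by
    simp
  obtain ⟨out, hout⟩ := exists_testLoop m F (finite_newtonVertices F).toFinset.toList
    fun β hβ => (hmem β).1 hβ
  exact ⟨out, _, Finset.nodup_toList _, hmem, hout⟩

/-- For any `r`, the leading exponents of `F` determine a vertex. The run has tested that vertex,
possibly at other radii, but these give an order equivalent to the original one. -/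
theorem isUAGB_of_testUAGB {m : MonomialOrder.{0, 0} (Fin n)}
    {F : Fin s → MvPolynomial (Fin n) K} (hF : ∀ i, F i ≠ 0) (h : TestUAGB m F none) :
    IsUAGB m (Ideal.span (Set.range F)) (Set.range F) := by
  obtain ⟨l, -, hl, hloop⟩ := h
  refine ⟨Set.finite_range F, Ideal.subset_span, fun r => ?_⟩
  choose α hα using fun i => exists_isLeadingExp_of_ne_zero ⟨r, m⟩ (hF i)
  have hsupp : ∀ i, α i ∈ (F i).support := fun i => by simpa using (hα i).1
  obtain ⟨r', hr'⟩ := TermOrder.exists_strict_radii ⟨r, m⟩ F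
  -- The perturbed radii `r'` serve only to show that the point is a vertex; the `u` used by the run
  -- may differ from `-r'`.
  have hchar : Characterizes F (ratToReal (newtonPoint F α)) (-r') := by
    rw [characterizes_newtonPoint_iff hsupp, neg_neg]
    exact fun i => hr' i _ (hα i)
  obtain ⟨u, hu, hGB⟩ := hloop.exists_isLocalGB ((hl _).2 hchar.mem_newtonVertices)
  rw [characterizes_newtonPoint_iff hsupp] at hu
  refine TermOrder.Equivalent.isLocalGB ?_ hGB
  refine TermOrder.equivalent_of_isLeadingExp fun i e he => ?_
  rw [he.unique (hα i)]
  exact isLeadingExp_of_strict _ (hsupp i) (hu i)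

end Correctness

end TateGB

end

theorem mainTheorem9 {K : Type*} [Field K] [Valued K ℤᵐ⁰] [CompleteSpace K]
    (hπ : ∃ π : K, Valued.v π = WithZero.exp (-1 : ℤ))
    (n s : ℕ) (m : MonomialOrder.{0, 0} (Fin n)) (F : Fin s → MvPolynomial (Fin n) K) :
    (∀ R : Set (TateGB.TermOrder n), TateGB.MeetsAllClasses F R →
      (TateGB.IsUAGB m (Ideal.span (Set.range F)) (Set.range F) ↔
        ∀ o ∈ R, o.IsLocalGB (Ideal.span (Set.range F)) (Set.range F))) ∧
    ((∀ i, F i ≠ 0) →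
      (∃ out, TateGB.TestUAGB m F out) ∧
      (∀ out, TateGB.TestUAGB m F out →
        (out = none ↔ TateGB.IsUAGB m (Ideal.span (Set.range F)) (Set.range F)) ∧
        (∀ r, out = some r →
          ¬ TateGB.TermOrder.IsLocalGB ⟨r, m⟩ (Ideal.span (Set.range F)) (Set.range F)))) := by
  refine ⟨fun R hR => TateGB.isUAGB_iff_of_meetsAllClasses hR,
    fun hF => ⟨TateGB.exists_testUAGB m F, fun out hout => ?_⟩⟩
  have hfail : ∀ r, out = some r →
      ¬ TateGB.TermOrder.IsLocalGB ⟨r, m⟩ (Ideal.span (Set.range F)) (Set.range F) := by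
    rintro r rfl
    obtain ⟨l, -, -, hloop⟩ := hout
    exact hloop.not_isLocalGB
  refine ⟨⟨?_, fun hU => ?_⟩, hfail⟩
  · rintro rfl
    exact TateGB.isUAGB_of_testUAGB hF hout
  · cases out with
    | none => rfl
    | some r => exact absurd (hU.2.2 r) (hfail r rfl)
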